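/- **Theorem 1 (Wehrl-$p$ EPI).** Consider $D\ge 1$ bosonic modes with annihilation operators $a_1,\dots,a_D$ on Fock space with number states $|n\rangle$, $n\in\mathbb N^D$. A density operator $\rho$ is a *Gaussian state* if its characteristic function $\chi(\xi)=\mathrm{Tr}\big(\rho\, e^{\sum_j(\xi_j a_j^\dagger-\bar\xi_j a_j)}\big)$, $\xi\in\mathbb C^D$, has the form $\exp\big(i\,d\cdot x-\tfrac12 x^{T}Vx\big)$ with $x=(\mathrm{Re}\,\xi,\mathrm{Im}\,\xi)\in\mathbb R^{2D}$, for some $d\in\mathbb R^{2D}$ and some real symmetric $2D\times 2D$ matrix $V$. The Husimi function of $\rho$ is $Q_\rho(\alpha)=\pi^{-D}\langle\alpha|\rho|\alpha\rangle$, $\alpha\in\mathbb C^D$, with the coherent states $|\alpha\rangle=e^{-|\alpha|^2/2}\sum_n\frac{\alpha^n}{\sqrt{n!}}|n\rangle$. For $p>1$ let $$S_p^W(\rho)=\frac1{1-p}\log\int_{\mathbb C^D}Q_\rho(\alpha)^p\,d\alpha,\qquad \mathbf V_p^W(\rho)=\exp\Big(\frac1D S_p^W(\rho)\Big),\qquad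 \mathbf V_p^{W,\kappa}(\rho)=\big(\mathbf V_p^W(\rho)\big)^\kappa ,$$ where $d\alpha$ is Lebesgue measure on $\mathbb C^D$. For $\tau\in(0,1)$ let $\rho_X\boxplus_\tau\rho_Y=\mathrm{Tr}_Y\big[U_\tau(\rho_X\otimes\rho_Y)U_\tau^\dagger\big]$, where $U_\tau$ is the beam-splitter unitary, which fixes the vacuum and satisfies $U_\tau^\dagger a_{X,j}U_\tau=\sqrt\tau\,a_{X,j}+\sqrt{1-\tau}\,a_{Y,j}$ and $U_\tau^\dagger a_{Y,j}U_\tau=\sqrt\tau\,a_{Y,j}-\sqrt{1-\tau}\,a_{X,j}$ for $j=1,\dots,D$. Let $\rho_X,\rho_Y$ be $D$-mode Gaussian states, $\tau\in(0,1)$, $p>1$ and $\kappa\ge\frac{p+1}2$. Then $\rho_Z=\rho_X\boxplus_\tau\rho_Y$ is a $D$-mode Gaussian state, the integrals $\int Q_\rho^p$ for $\rho\in\{\rho_X,\rho_Y,\rho_Z\}$ are finite and positive, and $$\mathbf V_p^{W,\kappa}(\rho_Z)\ \ge\ \tau^\kappa\,\mathbf V_p^{W,\kappa}(\rho_X)+(1-\tau)^\kappa\,\mathbf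 V_p^{W,\kappa}(\rho_Y).$$ -/

import Mathlib

open MeasureTheory
open scoped Matrix Kronecker Nat ComplexConjugate ComplexOrder

noncomputable section

/-! Operators on the bosonic Fock space are written as infinite matrices in the number basis.
`D` modes: the number state `|n⟩` is labelled by the occupation numbers `n : Fin D → ℕ`. -/

namespace Bosonic

/-- Occupation numbers of `D` modes; these label the number states `|n⟩`, an orthonormal basis of
the `D`-mode Fock space. -/
abbrev Occ (D : ℕ) : Type := Fin D → ℕ

/-- The multi-index factorial `n! = ∏ⱼ nⱼ!`. -/
def occFactorial {D : ℕ} (n : Occ D) : ℕ := ∏ j, (n j)!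

/-- Product of two infinite matrices. -/
def opMul {ι κ l : Type} (A : Matrix ι κ ℂ) (B : Matrix κ l ℂ) : Matrix ι l ℂ :=
  fun i j => ∑' k, A i k * B k j

/-- Trace of an infinite matrix. -/
def opTrace {ι : Type} (A : Matrix ι ι ℂ) : ℂ := ∑' i, A i i

/-- Partial trace over the second factor: `⟨m|Tr₂ A|m'⟩ = ∑ₖ ⟨m,k|A|m',k⟩`. -/
def partialTrace {ι κ : Type} (A : Matrix (ι × κ) (ι × κ) ℂ) : Matrix ι ι ℂ :=
  fun m m' => ∑' k, A (m, k) (m', k)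

/-- Density operators, through their matrix elements `⟨m|ρ|n⟩` in the number basis: positive
semidefinite (on all finite linear combinations of number states) with trace one. -/
def IsDensity {D : ℕ} (ρ : Matrix (Occ D) (Occ D) ℂ) : Prop :=
  ρ.PosSemidef ∧ HasSum (fun n => ρ n n) 1

/-- The matrix elements
`⟨m| exp(∑ⱼ ξⱼ aⱼ†) |k⟩ = ∏ⱼ √(mⱼ! / kⱼ!) ξⱼ ^ (mⱼ - kⱼ) / (mⱼ - kⱼ)!` (zero unless `k ≤ m`),
where `a† |n⟩ = √(n + 1) |n + 1⟩`. -/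
def expCreation {D : ℕ} (ξ : Fin D → ℂ) : Matrix (Occ D) (Occ D) ℂ := fun m k =>
  ∏ j, if k j ≤ m j then
    ((Real.sqrt (((m j)! : ℝ) / ((k j)! : ℝ)) : ℝ) : ℂ) * ξ j ^ (m j - k j) / ((m j - k j)! : ℂ)
  else 0

/-- The Weyl displacement operator `D(ξ) = exp(∑ⱼ (ξⱼ aⱼ† - ξ̄ⱼ aⱼ))`, in its normally ordered form
`exp(-|ξ|²/2) exp(∑ⱼ ξⱼ aⱼ†) exp(-∑ⱼ ξ̄ⱼ aⱼ)`; the last factor is the adjoint of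
`exp(-∑ⱼ ξⱼ aⱼ†)`. -/
def displacement {D : ℕ} (ξ : Fin D → ℂ) : Matrix (Occ D) (Occ D) ℂ :=
  ((Real.exp (-(∑ j, ‖ξ j‖ ^ 2) / 2) : ℝ) : ℂ) •
    opMul (expCreation ξ) (expCreation (-ξ))ᴴ

/-- The (Wigner) characteristic function `χ(ξ) = Tr(ρ D(ξ))`. -/
def charFn {D : ℕ} (ρ : Matrix (Occ D) (Occ D) ℂ) (ξ : Fin D → ℂ) : ℂ :=
  opTrace (opMul ρ (displacement ξ))

/-- The real phase-space coordinates `(Re ξ, Im ξ)` of `ξ ∈ ℂ^D`. -/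
def realCoord {D : ℕ} (ξ : Fin D → ℂ) : Fin D ⊕ Fin D → ℝ :=
  Sum.elim (fun j => (ξ j).re) (fun j => (ξ j).im)

/-- `D`-mode Gaussian states: density operators whose characteristic function is Gaussian,
`χ(ξ) = exp(i d·x - xᵀ V x / 2)` with `x = (Re ξ, Im ξ)`. -/
def IsGaussianState {D : ℕ} (ρ : Matrix (Occ D) (Occ D) ℂ) : Prop :=
  IsDensity ρ ∧
    ∃ (d : Fin D ⊕ Fin D → ℝ) (V : Matrix (Fin D ⊕ Fin D) (Fin D ⊕ Fin D) ℝ), V.IsSymm ∧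
      ∀ ξ : Fin D → ℂ, charFn ρ ξ =
        Complex.exp (Complex.I * ((d ⬝ᵥ realCoord ξ : ℝ) : ℂ)
          - (((realCoord ξ ⬝ᵥ V *ᵥ realCoord ξ) / 2 : ℝ) : ℂ))

/-- The amplitude `⟨n|α⟩ = exp(-|α|²/2) ∏ⱼ αⱼ ^ nⱼ / √(nⱼ!)` of the coherent state `|α⟩`. -/
def coherent {D : ℕ} (α : Fin D → ℂ) (n : Occ D) : ℂ :=
  ((Real.exp (-(∑ j, ‖α j‖ ^ 2) / 2) : ℝ) : ℂ) *
    ((∏ j, α j ^ n j) / ((Real.sqrt (occFactorial n : ℝ) : ℝ) : ℂ))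

/-- The Husimi function `Q(α) = π^(-D) ⟨α|ρ|α⟩`, normalized to be a probability density for
Lebesgue measure on `ℂ^D`. -/
def husimi {D : ℕ} (ρ : Matrix (Occ D) (Occ D) ℂ) (α : Fin D → ℂ) : ℝ :=
  (∑' m, ∑' n, conj (coherent α m) * ρ m n * coherent α n).re / Real.pi ^ D

/-- The Wehrl–Rényi entropy `(1 - p)⁻¹ log ∫ Q(α)^p dα`. -/
def wehrlEntropy {D : ℕ} (p : ℝ) (ρ : Matrix (Occ D) (Occ D) ℂ) : ℝ :=
  1 / (1 - p) * Real.log (∫ α : Fin D → ℂ, husimi ρ α ^ p)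

/-- The Wehrl–Rényi entropy power `exp(S / D)`. -/
def wehrlPower {D : ℕ} (p : ℝ) (ρ : Matrix (Occ D) (Occ D) ℂ) : ℝ :=
  Real.exp (1 / (D : ℝ) * wehrlEntropy p ρ)

/-- The beam-splitter unitary `U` of transmissivity `τ` (mode by mode), which acts on the creation
operators of the two inputs by `U aⱼ† U† = √τ aⱼ† - √(1-τ) bⱼ†`, `U bⱼ† U† = √(1-τ) aⱼ† + √τ bⱼ†`
and fixes the vacuum, equivalently `U† aⱼ U = √τ aⱼ + √(1-τ) bⱼ`. Hence
`U |m,k⟩ = (m! k!)^(-1/2) ∏ⱼ (√τ aⱼ† - √(1-τ) bⱼ†)^mⱼ (√(1-τ) aⱼ† + √τ bⱼ†)^kⱼ |0⟩`, and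
`⟨m',k'|U|m,k⟩` is `√(m'! k'! / (m! k!))` times the coefficient of `a†^m' b†^k'` in this polynomial
in the commuting creation operators. -/
def beamSplitterU {D : ℕ} (τ : ℝ) : Matrix (Occ D × Occ D) (Occ D × Occ D) ℂ := fun out inp =>
  ((Real.sqrt (((occFactorial out.1 * occFactorial out.2 : ℕ) : ℝ) /
      ((occFactorial inp.1 * occFactorial inp.2 : ℕ) : ℝ)) : ℝ) : ℂ) *
    MvPolynomial.coeff (Finsupp.equivFunOnFinite.symm (Sum.elim out.1 out.2))
      (∏ j : Fin D,
        ((MvPolynomial.C ((Real.sqrt τ : ℝ) : ℂ) * MvPolynomial.X (Sum.inl j)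
            - MvPolynomial.C ((Real.sqrt (1 - τ) : ℝ) : ℂ) * MvPolynomial.X (Sum.inr j)) ^ inp.1 j *
          (MvPolynomial.C ((Real.sqrt (1 - τ) : ℝ) : ℂ) * MvPolynomial.X (Sum.inl j)
            + MvPolynomial.C ((Real.sqrt τ : ℝ) : ℂ) * MvPolynomial.X (Sum.inr j)) ^ inp.2 j :
        MvPolynomial (Fin D ⊕ Fin D) ℂ))

/-- The quantum convolution `ρX ⊞_τ ρY = Tr_Y[U (ρX ⊗ ρY) U†]`. -/
def quantumConv {D : ℕ} (τ : ℝ) (ρX ρY : Matrix (Occ D) (Occ D) ℂ) : Matrix (Occ D) (Occ D) ℂ :=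
  partialTrace (opMul (opMul (beamSplitterU τ) (ρX ⊗ₖ ρY)) (beamSplitterU τ)ᴴ)

end Bosonic

end

/-! Everything reduces to one determinant. The Fourier transform of the Husimi function is
`exp(-|ξ|²/2) χ(ξ)`, so for a Gaussian state with matrix `V` the Husimi function is a Gaussian
density governed by `V + 1`. An affine change of variables carries it to the vacuum Husimi function,
and the entropy power becomes a constant depending on `D` and `p` times `det(V + 1)^(1/(2D))`
(`HasGaussianCharFn.wehrlPower_eq`).

The beam splitter acts on coherent states as a rotation of the joint phase space. Hence `χ_Z(ξ) =
χ_X(√τ ξ) χ_Y(√(1-τ) ξ)` (`charFn_quantumConv`), so `ρ_Z` is Gaussian with `V_Z + 1 = τ (V_X + 1) +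
(1-τ) (V_Y + 1)`. Minkowski's determinant inequality for `2D × 2D` matrices gives the claim with
exponent one. Since `κ ≥ (p + 1)/2 > 1`, the general case follows from monotonicity and
superadditivity of `x ↦ x^κ` on nonnegative reals.

Most of the work justifies the formal operations on infinite matrices. A positive semidefinite
matrix of finite trace is a Gram matrix of square-summable vectors, and the normalized coherent
amplitudes are orthonormal in `L²`. Traces against multiplication operators thus become inner
products of vector-valued `L²` functions (`IsL2Orthonormal.trace_formula`), and the interchanges of
sums and integrals are Hilbert-space continuity. -/

/-! ### Gram vectors of positive semidefinite infinite matrices -/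

/-- Moore–Aronszajn: `M`, read as a kernel with values in operators on `ℂ`, has a reproducing kernel
Hilbert space, whose kernel functions are the Gram vectors. -/
theorem Matrix.PosSemidef.exists_gram {ι : Type} {M : Matrix ι ι ℂ} (hM : M.PosSemidef) :
    ∃ (H : Type) (_ : NormedAddCommGroup H) (_ : InnerProductSpace ℂ H) (_ : CompleteSpace H)
      (v : ι → H), ∀ i j, M i j = inner ℂ (v i) (v j) := by
  let K : Matrix ι ι (ℂ →L[ℂ] ℂ) := fun i j => M i j • ContinuousLinearMap.id ℂ ℂ
  have hK : K.PosSemidef := by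
    have h3 := (RKHS.posSemidef_tfae (K := K)).out 0 2
    refine h3.2 ⟨?_, fun f => ?_⟩
    · refine Matrix.IsHermitian.ext fun i j => ?_
      change star (M j i • (1 : ℂ →L[ℂ] ℂ)) = M i j • (1 : ℂ →L[ℂ] ℂ)
      rw [star_smul, star_one, hM.1.apply]
    · have h := hM.2 f
      rw [Complex.nonneg_iff] at h
      convert h.1 using 2
      simp only [RCLike.re_to_complex]
      congr 1
      refine Finsupp.sum_congr fun i _ => Finsupp.sum_congr fun j _ => ?_
      rw [← hM.1.apply i j]
      simp [K]
      ring
  have : Fact K.PosSemidef := ⟨hK⟩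
  refine ⟨RKHS.OfKernel K, inferInstance, inferInstance, inferInstance,
    fun i => RKHS.kerFun (RKHS.OfKernel K) i 1, fun i j => ?_⟩
  rw [← RKHS.kernel_inner, RKHS.OfKernel.kernel_ofKernel, ← hM.1.apply i j]
  simp [K]

/-! ### Vector-valued `L²` expansions and the trace formula -/

section L2

variable {ι X H : Type} [MeasurableSpace X] {μ : Measure X}
  [NormedAddCommGroup H] [InnerProductSpace ℂ H]

/-- A family of functions which is orthonormal in `L²`. -/
structure IsL2Orthonormal (μ : Measure X) (e : ι → X → ℂ) : Prop where
  memLp : ∀ i, MemLp (e i) 2 μ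
  integral_eq_one : ∀ i, ∫ x, conj (e i x) * e i x ∂μ = 1
  integral_eq_zero : ∀ i j, i ≠ j → ∫ x, conj (e i x) * e j x ∂μ = 0

theorem MeasureTheory.MemLp.smul_const_vector {f : X → ℂ} (hf : MemLp f 2 μ) (v : H) :
    MemLp (fun x => f x • v) 2 μ :=
  (((ContinuousLinearMap.toSpanSingleton ℂ v)).comp_memLp' hf)

theorem inner_toLp_smul_toLp_smul {f g : X → ℂ} (hf : MemLp f 2 μ) (hg : MemLp g 2 μ) (v w : H) :
    inner ℂ (hf.smul_const_vector v).toLp (hg.smul_const_vector w).toLp =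
      (∫ x, conj (f x) * g x ∂μ) * inner ℂ v w := by
  rw [L2.inner_def, ← integral_mul_const]
  refine integral_congr_ae ?_
  filter_upwards [(hf.smul_const_vector v).coeFn_toLp, (hg.smul_const_vector w).coeFn_toLp]
    with x h1 h2
  rw [h1, h2, inner_smul_left, inner_smul_right]
  ring

/-- The isometry `v ↦ e ⊗ v` for a normalized `e ∈ L²`. -/
noncomputable def IsL2Orthonormal.tensor {e : ι → X → ℂ} (he : IsL2Orthonormal μ e) (i : ι) :
    H →ₗᵢ[ℂ] Lp H 2 μ :=
  LinearMap.isometryOfInner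
    { toFun := fun v => ((he.memLp i).smul_const_vector v).toLp
      map_add' := fun v w => by
        rw [← MemLp.toLp_add]
        congr 1
        ext x
        simp
      map_smul' := fun c v => by
        rw [RingHom.id_apply, ← MemLp.toLp_const_smul]
        congr 1
        ext x
        exact smul_comm _ _ _ }
    (fun v w => by
      have := inner_toLp_smul_toLp_smul (he.memLp i) (he.memLp i) v w
      simpa [he.integral_eq_one i] using this)

theorem IsL2Orthonormal.orthogonalFamily {e : ι → X → ℂ} (he : IsL2Orthonormal μ e) :
    OrthogonalFamily ℂ (fun _ : ι => H) (fun i => he.tensor i) := by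
  intro i j hij v w
  have := inner_toLp_smul_toLp_smul (he.memLp i) (he.memLp j) v w
  rw [he.integral_eq_zero i j hij, zero_mul] at this
  exact this

theorem summable_norm_smul {e : ι → ℂ} {v : ι → H} (he : Summable fun i => ‖e i‖ ^ 2)
    (hv : Summable fun i => ‖v i‖ ^ 2) : Summable fun i => ‖e i • v i‖ := by
  refine Summable.of_nonneg_of_le (fun i => norm_nonneg _) (fun i => ?_) (he.add hv)
  rw [norm_smul]
  nlinarith [sq_nonneg (‖e i‖ - ‖v i‖), sq_nonneg (‖e i‖), sq_nonneg (‖v i‖)]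

/-- Orthogonality gives convergence in `L²`, Cauchy–Schwarz gives convergence at each point. The
lemma says that the two limits agree, so the abstract sum can be evaluated pointwise. -/
theorem IsL2Orthonormal.hasSum_tensor [Countable ι] [CompleteSpace H] {e : ι → X → ℂ}
    (he : IsL2Orthonormal μ e) (hx : ∀ x, Summable fun i => ‖e i x‖ ^ 2) {v : ι → H}
    (hv : Summable fun i => ‖v i‖ ^ 2) :
    ∃ G : Lp H 2 μ, HasSum (fun i => he.tensor i (v i)) G ∧ G =ᵐ[μ] fun x => ∑' i, e i x • v i := by
  have hs : Summable (fun i => he.tensor i (v i)) :=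
    (he.orthogonalFamily.summable_iff_norm_sq_summable v).2 hv
  refine ⟨_, hs.hasSum, ?_⟩
  have hL : ∀ i, he.tensor i (v i) = ((he.memLp i).smul_const_vector (v i)).toLp := fun i => rfl
  have ht := hs.hasSum
  rw [HasSum, SummationFilter.unconditional_filter] at ht
  -- Countability of `ι` gives a cofinal sequence of finite sets. Along it, `L²` convergence implies
  -- convergence in measure, hence almost everywhere convergence of a subsequence.
  obtain ⟨S, hS⟩ : ∃ S : ℕ → Finset ι, Filter.Tendsto S Filter.atTop Filter.atTop :=
    Filter.exists_seq_tendsto _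
  have h1 : TendstoInMeasure μ (fun n => ((∑ i ∈ S n, he.tensor i (v i) : Lp H 2 μ) : X → H))
      Filter.atTop (∑' i, he.tensor i (v i) : Lp H 2 μ) :=
    tendstoInMeasure_of_tendsto_Lp (ht.comp hS)
  obtain ⟨ns, hns, hae⟩ := h1.exists_seq_tendsto_ae
  have h2 : ∀ᵐ x ∂μ, ∀ n, ((∑ i ∈ S n, he.tensor i (v i) : Lp H 2 μ) : X → H) x =
      ∑ i ∈ S n, e i x • v i := by
    rw [ae_all_iff]
    intro n
    have h3 : ∀ᵐ x ∂μ, ∀ i, (he.tensor i (v i) : X → H) x = e i x • v i := by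
      rw [ae_all_iff]
      intro i
      rw [hL]
      exact ((he.memLp i).smul_const_vector (v i)).coeFn_toLp
    filter_upwards [h3, Lp.coeFn_finsetSum (S n) (fun i => he.tensor i (v i))] with x h3 h4
    rw [h4, Finset.sum_apply]
    exact Finset.sum_congr rfl fun i _ => h3 i
  filter_upwards [hae, h2] with x h5 h6
  have h7 := (summable_norm_smul (hx x) hv).of_norm.hasSum
  rw [HasSum, SummationFilter.unconditional_filter] at h7
  refine tendsto_nhds_unique h5 ?_
  simp only [h6]
  exact (h7.comp hS).comp hns.tendsto_atTop

/-- The quadratic form `∑ₘ ∑ₙ c̄ₘ Mₘₙ cₙ` of an infinite matrix. -/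
noncomputable def quadForm (M : Matrix ι ι ℂ) (c : ι → ℂ) : ℂ := ∑' m, ∑' n, conj (c m) * M m n * c n

/-- `quadForm` is an iterated sum, so the continuous functional `⟨c m • v m, ·⟩` is applied to the
inner series and the outer sum is treated in the same way. -/
theorem quadForm_eq_inner [CompleteSpace H] {M : Matrix ι ι ℂ} {v : ι → H}
    (hM : ∀ i j, M i j = inner ℂ (v i) (v j)) (hv : Summable fun i => ‖v i‖ ^ 2) {c : ι → ℂ}
    (hc : Summable fun i => ‖c i‖ ^ 2) :
    quadForm M c = inner ℂ (∑' i, c i • v i) (∑' i, c i • v i) := by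
  have hs := (summable_norm_smul hc hv).of_norm
  unfold quadForm
  have h1 : ∀ m, ∑' n, conj (c m) * M m n * c n = inner ℂ (c m • v m) (∑' i, c i • v i) := by
    intro m
    rw [← innerSL_apply_apply ℂ, (innerSL ℂ _).map_tsum hs]
    refine tsum_congr fun n => ?_
    rw [innerSL_apply_apply, inner_smul_left, inner_smul_right, hM]
    ring
  simp_rw [h1]
  rw [← inner_conj_symm, ← innerSL_apply_apply ℂ, (innerSL ℂ _).map_tsum hs,
    ← Complex.conjCLE_apply, ContinuousLinearEquiv.map_tsum]
  refine tsum_congr fun n => ?_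
  rw [innerSL_apply_apply, Complex.conjCLE_apply, inner_conj_symm]

theorem quadForm_eq_ofReal [CompleteSpace H] {M : Matrix ι ι ℂ} {v : ι → H}
    (hM : ∀ i j, M i j = inner ℂ (v i) (v j)) (hv : Summable fun i => ‖v i‖ ^ 2) {c : ι → ℂ}
    (hc : Summable fun i => ‖c i‖ ^ 2) :
    quadForm M c = ((‖∑' i, c i • v i‖ ^ 2 : ℝ) : ℂ) := by
  rw [quadForm_eq_inner hM hv hc, inner_self_eq_norm_sq_to_K]
  simp

theorem Matrix.PosSemidef.exists_gram_summable {M : Matrix ι ι ℂ} (hM : M.PosSemidef)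
    (ht : Summable fun i => M i i) :
    ∃ (H : Type) (_ : NormedAddCommGroup H) (_ : InnerProductSpace ℂ H) (_ : CompleteSpace H)
      (v : ι → H), (∀ i j, M i j = inner ℂ (v i) (v j)) ∧ Summable fun i => ‖v i‖ ^ 2 := by
  obtain ⟨H, i1, i2, i3, v, hv⟩ := hM.exists_gram
  refine ⟨H, i1, i2, i3, v, hv, ?_⟩
  rw [← Complex.summable_ofReal]
  refine ht.congr fun i => ?_
  rw [hv, inner_self_eq_norm_sq_to_K]
  simp

theorem Matrix.PosSemidef.quadForm_nonneg {M : Matrix ι ι ℂ} (hM : M.PosSemidef)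
    (ht : Summable fun i => M i i) {c : ι → ℂ} (hc : Summable fun i => ‖c i‖ ^ 2) :
    0 ≤ quadForm M c := by
  obtain ⟨H, i1, i2, i3, v, hv, hs⟩ := hM.exists_gram_summable ht
  rw [quadForm_eq_ofReal hv hs hc]
  rw [Complex.zero_le_real]
  exact sq_nonneg _

theorem IsL2Orthonormal.mul_unimodular {e : ι → X → ℂ} (he : IsL2Orthonormal μ e) {h : X → ℂ}
    (hm : Measurable h) (hh : ∀ x, ‖h x‖ = 1) : IsL2Orthonormal μ (fun i x => h x * e i x) := by
  have key : ∀ i j x, conj (h x * e i x) * (h x * e j x) = conj (e i x) * e j x := by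
    intro i j x
    have : conj (h x) * h x = 1 := by
      rw [Complex.conj_mul', hh]; simp
    rw [map_mul]
    linear_combination (conj (e i x) * e j x) * this
  refine ⟨fun i => ?_, fun i => ?_, fun i j hij => ?_⟩
  · refine (he.memLp i).of_le (hm.aestronglyMeasurable.mul (he.memLp i).1) (ae_of_all _ fun x => ?_)
    rw [norm_mul, hh, one_mul]
  · simp_rw [key]; exact he.integral_eq_one i
  · simp_rw [key]; exact he.integral_eq_zero i j hij

/-- This is `Tr(M T)` for the Toeplitz-type matrix `T` of multiplication by `h`. With Gram vectors
`v`, both sides equal `⟨G, G'⟩` for `G = ∑ e i ⊗ v i` and `G' = ∑ (h e i) ⊗ v i`. As `h` is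
unimodular, the family `h e i` is again orthonormal, so `G'` exists; the iterated sum comes from
continuity of the inner product in each slot. -/
theorem IsL2Orthonormal.trace_formula [Countable ι] {e : ι → X → ℂ}
    (he : IsL2Orthonormal μ e) (hx : ∀ x, Summable fun i => ‖e i x‖ ^ 2) {M : Matrix ι ι ℂ}
    (hM : M.PosSemidef) (ht : Summable fun i => M i i) {h : X → ℂ}
    (hm : Measurable h) (hh : ∀ x, ‖h x‖ = 1) :
    Integrable (fun x => quadForm M (fun i => e i x)) μ ∧
    (∀ i, Summable fun k => M i k * ∫ x, conj (e i x) * e k x * h x ∂μ) ∧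
    HasSum (fun i => ∑' k, M i k * ∫ x, conj (e i x) * e k x * h x ∂μ)
      (∫ x, quadForm M (fun i => e i x) * h x ∂μ) := by
  obtain ⟨H, i1, i2, i3, v, hv, hs⟩ := hM.exists_gram_summable ht
  have he' := he.mul_unimodular hm hh
  have hx' : ∀ x, Summable fun i => ‖h x * e i x‖ ^ 2 := by
    intro x
    simpa [norm_mul, hh] using hx x
  obtain ⟨G, hG, hGe⟩ := he.hasSum_tensor hx hs
  obtain ⟨G', hG', hGe'⟩ := he'.hasSum_tensor hx' hs
  have hin : ∀ i k, inner ℂ (he.tensor i (v i)) (he'.tensor k (v k)) =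
      M i k * ∫ x, conj (e i x) * e k x * h x ∂μ := by
    intro i k
    have := inner_toLp_smul_toLp_smul (he.memLp i) (he'.memLp k) (v i) (v k)
    rw [hv, mul_comm]
    refine this.trans ?_
    congr 2
    ext x
    ring
  have h1 : ∀ i, HasSum (fun k => M i k * ∫ x, conj (e i x) * e k x * h x ∂μ)
      (inner ℂ (he.tensor i (v i)) G') := by
    intro i
    have := (innerSL ℂ (he.tensor i (v i))).hasSum hG'
    simpa only [innerSL_apply_apply, Function.comp_def, hin] using this
  have h2 : HasSum (fun i => inner ℂ (he.tensor i (v i)) G') (inner ℂ G G') := by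
    have := Complex.conjCLE.hasSum'.2 ((innerSL ℂ G').hasSum hG)
    simpa only [innerSL_apply_apply, Function.comp_def, Complex.conjCLE_apply,
      inner_conj_symm] using this
  have h3 : ∀ x, quadForm M (fun i => e i x) =
      inner ℂ (∑' i, e i x • v i) (∑' i, e i x • v i) := fun x => quadForm_eq_inner hv hs (hx x)
  refine ⟨?_, fun i => (h1 i).summable, ?_⟩
  · refine (L2.integrable_inner (𝕜 := ℂ) G G).congr ?_
    filter_upwards [hGe] with x h4
    rw [h4, h3]
  · simp_rw [fun i => (h1 i).tsum_eq]
    convert h2 using 1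
    rw [L2.inner_def]
    refine integral_congr_ae ?_
    filter_upwards [hGe, hGe'] with x h4 h5
    simp only [h4, h5, h3, mul_smul]
    rw [(summable_norm_smul (hx x) hs).of_norm.tsum_const_smul, inner_smul_right]
    ring

end L2

/-! ### Gaussian moments on the complex plane -/

section GaussianMoments

/-- The integrand splits into one-dimensional Gaussians in `Re α` and `Im α`, with linear
coefficients `ξ + η` and `i(η - ξ)`; completing squares leaves `((ξ + η)² - (η - ξ)²)/4 = ξ η`. -/
theorem integral_cexp_neg_sq_norm_add_complex (ξ η : ℂ) :
    ∫ α : ℂ, Complex.exp (-(‖α‖ ^ 2 : ℝ) + ξ * conj α + η * α) = Real.pi * Complex.exp (ξ * η) := by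
  rw [← Complex.volume_preserving_equiv_real_prod.symm.integral_comp
    (MeasurableEquiv.measurableEmbedding _)]
  have h : ∀ x : ℝ × ℝ, Complex.exp (-(‖Complex.measurableEquivRealProd.symm x‖ ^ 2 : ℝ)
      + ξ * conj (Complex.measurableEquivRealProd.symm x)
      + η * Complex.measurableEquivRealProd.symm x) =
      Complex.exp ((-1) * x.1 ^ 2 + (ξ + η) * x.1 + 0) *
      Complex.exp ((-1) * x.2 ^ 2 + (Complex.I * (η - ξ)) * x.2 + 0) := by
    intro x
    rw [← Complex.exp_add, ← Complex.normSq_eq_norm_sq]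
    congr 1
    have : Complex.measurableEquivRealProd.symm x = (x.1 : ℂ) + x.2 * Complex.I := by
      apply Complex.ext <;> simp [Complex.measurableEquivRealProd_symm_apply]
    rw [this, Complex.normSq_add_mul_I]
    simp
    ring
  simp_rw [h]
  rw [Measure.volume_eq_prod, integral_prod_mul
    (fun x : ℝ => Complex.exp ((-1) * (x : ℂ) ^ 2 + (ξ + η) * x + 0))
    (fun x : ℝ => Complex.exp ((-1) * (x : ℂ) ^ 2 + (Complex.I * (η - ξ)) * x + 0)),
    integral_cexp_quadratic (by simp), integral_cexp_quadratic (by simp)]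
  have h2 : ((Real.pi : ℂ) / - -1) ^ (1 / 2 : ℂ) * ((Real.pi : ℂ) / - -1) ^ (1 / 2 : ℂ) = Real.pi := by
    rw [← Complex.cpow_add _ _ (by simp)]
    norm_num
  rw [mul_mul_mul_comm, h2, ← Complex.exp_add]
  congr 2
  ring_nf
  rw [Complex.I_sq]
  ring

theorem integrable_exp_neg_sq_norm_add_mul_norm (c : ℝ) :
    Integrable (fun α : ℂ => Real.exp (-‖α‖ ^ 2 + c * ‖α‖)) := by
  have h := (GaussianFourier.integrable_cexp_neg_mul_sq_norm_add (V := ℂ) (b := (1 / 2 : ℂ))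
    (by norm_num) 0 0).norm.const_mul (Real.exp (c ^ 2 / 2))
  refine h.mono' (by fun_prop) (ae_of_all _ fun α => ?_)
  rw [Complex.norm_exp, ← Real.exp_add, Real.norm_eq_abs, Real.abs_exp, Real.exp_le_exp]
  have : (-(1 / 2 : ℂ) * (‖α‖ : ℂ) ^ 2 + 0 * ((inner ℝ (0 : ℂ) α : ℝ) : ℂ)).re = -(1 / 2) * ‖α‖ ^ 2 := by
    rw [zero_mul, add_zero]
    have h2 : (-(1 / 2 : ℂ) * (‖α‖ : ℂ) ^ 2) = ((-(1 / 2) * ‖α‖ ^ 2 : ℝ) : ℂ) := by push_cast; ring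
    rw [h2, Complex.ofReal_re]
  rw [this]
  nlinarith [sq_nonneg (‖α‖ - c)]

theorem hasDerivAt_integral_mul_cexp {g w : ℂ → ℂ} (hg : Continuous g) (hw : Continuous w)
    (hwn : ∀ α, ‖w α‖ = ‖α‖) {C c : ℝ} (hgb : ∀ α, ‖g α‖ ≤ C * Real.exp (-‖α‖ ^ 2 + c * ‖α‖))
    (s₀ : ℂ) :
    HasDerivAt (fun s => ∫ α, g α * Complex.exp (s * w α))
      (∫ α, g α * w α * Complex.exp (s₀ * w α)) s₀ := by
  have hC : 0 ≤ C := by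
    have := (norm_nonneg _).trans (hgb 0)
    simpa using this
  have hcont : ∀ s, Continuous fun α => g α * Complex.exp (s * w α) := fun s => by fun_prop
  have hexp : ∀ s α, ‖Complex.exp (s * w α)‖ ≤ Real.exp (‖s‖ * ‖α‖) := by
    intro s α
    rw [Complex.norm_exp, Real.exp_le_exp]
    refine (Complex.re_le_norm _).trans ?_
    rw [norm_mul, hwn]
  have hb1 : ∀ s α, ‖g α * Complex.exp (s * w α)‖ ≤
      C * Real.exp (-‖α‖ ^ 2 + (c + ‖s‖) * ‖α‖) := by
    intro s α
    rw [norm_mul, add_mul, ← add_assoc, Real.exp_add _ (‖s‖ * ‖α‖), ← mul_assoc]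
    exact mul_le_mul (hgb α) (hexp s α) (norm_nonneg _) (by positivity)
  refine (hasDerivAt_integral_of_dominated_loc_of_deriv_le (Metric.ball_mem_nhds s₀ one_pos)
    (F' := fun s α => g α * w α * Complex.exp (s * w α))
    -- On the unit ball about `s₀` one has `‖s‖ ≤ ‖s₀‖ + 1`; the last `1` absorbs the factor `‖w α‖
    -- = ‖α‖ ≤ exp ‖α‖` produced by differentiation.
    (bound := fun α => C * Real.exp (-‖α‖ ^ 2 + (c + (‖s₀‖ + 1) + 1) * ‖α‖))
    (Filter.Eventually.of_forall fun s => (hcont s).aestronglyMeasurable)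
    ?_ (by fun_prop : Continuous fun α => g α * w α * Complex.exp (s₀ * w α)).aestronglyMeasurable (ae_of_all _ fun α s hs => ?_) ?_
    (ae_of_all _ fun α s hs => ?_)).2
  · exact ((integrable_exp_neg_sq_norm_add_mul_norm _).const_mul C).mono'
      (hcont s₀).aestronglyMeasurable (ae_of_all _ (hb1 s₀))
  · have h1 : ‖s‖ ≤ ‖s₀‖ + 1 := by
      have := norm_sub_norm_le s s₀
      rw [Metric.mem_ball, dist_eq_norm] at hs
      linarith
    have h2 : ‖w α‖ ≤ Real.exp ‖α‖ := by
      rw [hwn]; linarith [Real.add_one_le_exp ‖α‖]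
    calc ‖g α * w α * Complex.exp (s * w α)‖
        = ‖g α * Complex.exp (s * w α)‖ * ‖w α‖ := by rw [mul_right_comm, norm_mul]
      _ ≤ (C * Real.exp (-‖α‖ ^ 2 + (c + ‖s‖) * ‖α‖)) * Real.exp ‖α‖ :=
          mul_le_mul (hb1 s α) h2 (norm_nonneg _) (by positivity)
      _ = C * Real.exp (-‖α‖ ^ 2 + (c + ‖s‖ + 1) * ‖α‖) := by
          rw [mul_assoc, ← Real.exp_add]; ring_nf
      _ ≤ _ := by gcongr
  · exact (integrable_exp_neg_sq_norm_add_mul_norm _).const_mul C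
  · have := ((hasDerivAt_id s).mul_const (w α)).cexp.const_mul (g α)
    refine this.congr_deriv ?_
    simp; ring

/-- The Gaussian moments `∫ ᾱⁱ αᵏ exp(-|α|² + ξ ᾱ + η α) dα`. -/
noncomputable def gaussMoment (i k : ℕ) (ξ η : ℂ) : ℂ :=
  ∫ α : ℂ, conj α ^ i * α ^ k * Complex.exp (-(‖α‖ ^ 2 : ℝ) + ξ * conj α + η * α)

theorem norm_gaussMoment_integrand_le (i k : ℕ) (ξ η α : ℂ) :
    ‖conj α ^ i * α ^ k * Complex.exp (-(‖α‖ ^ 2 : ℝ) + ξ * conj α + η * α)‖ ≤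
      (i + k)! * Real.exp (-‖α‖ ^ 2 + (‖ξ‖ + ‖η‖ + 1) * ‖α‖) := by
  have h1 : ‖conj α ^ i * α ^ k‖ ≤ (i + k)! * Real.exp ‖α‖ := by
    rw [norm_mul, norm_pow, norm_pow, RCLike.norm_conj, ← pow_add]
    have := Real.pow_div_factorial_le_exp ‖α‖ (norm_nonneg _) (i + k)
    rwa [div_le_iff₀' (by positivity)] at this
  have h2 : ‖Complex.exp (-(‖α‖ ^ 2 : ℝ) + ξ * conj α + η * α)‖ ≤
      Real.exp (-‖α‖ ^ 2 + (‖ξ‖ + ‖η‖) * ‖α‖) := by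
    rw [Complex.norm_exp, Real.exp_le_exp, Complex.add_re, Complex.add_re, Complex.neg_re,
      Complex.ofReal_re]
    have h3 := Complex.re_le_norm (ξ * conj α)
    have h4 := Complex.re_le_norm (η * α)
    rw [norm_mul, RCLike.norm_conj] at h3
    rw [norm_mul] at h4
    linarith
  rw [norm_mul]
  refine (mul_le_mul h1 h2 (norm_nonneg _) (by positivity)).trans_eq ?_
  rw [mul_assoc, ← Real.exp_add]
  ring_nf

theorem integrable_gaussMoment (i k : ℕ) (ξ η : ℂ) :
    Integrable fun α : ℂ => conj α ^ i * α ^ k *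
      Complex.exp (-(‖α‖ ^ 2 : ℝ) + ξ * conj α + η * α) :=
  ((integrable_exp_neg_sq_norm_add_mul_norm _).const_mul _).mono'
    (by fun_prop : Continuous _).aestronglyMeasurable
    (ae_of_all _ (norm_gaussMoment_integrand_le i k ξ η))

theorem hasDerivAt_gaussMoment_left (i k : ℕ) (ξ η : ℂ) :
    HasDerivAt (fun ξ => gaussMoment i k ξ η) (gaussMoment (i + 1) k ξ η) ξ := by
  have h := hasDerivAt_integral_mul_cexp (w := fun α => conj α) (by fun_prop) (by fun_prop)
    (fun α => RCLike.norm_conj α) (norm_gaussMoment_integrand_le i k 0 η) ξ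
  convert h using 1
  · ext s
    refine integral_congr_ae (ae_of_all _ fun α => ?_)
    have h1 : Complex.exp (-(‖α‖ ^ 2 : ℝ) + s * conj α + η * α) = Complex.exp (-(‖α‖ ^ 2 : ℝ) + 0 * conj α + η * α) * Complex.exp (s * conj α) := by
      rw [← Complex.exp_add]; congr 1; ring
    simp only [h1]
    ring
  · refine integral_congr_ae (ae_of_all _ fun α => ?_)
    have h1 : Complex.exp (-(‖α‖ ^ 2 : ℝ) + ξ * conj α + η * α) = Complex.exp (-(‖α‖ ^ 2 : ℝ) + 0 * conj α + η * α) * Complex.exp (ξ * conj α) := by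
      rw [← Complex.exp_add]; congr 1; ring
    simp only [h1]
    ring

theorem hasDerivAt_gaussMoment_right (i k : ℕ) (ξ η : ℂ) :
    HasDerivAt (fun η => gaussMoment i k ξ η) (gaussMoment i (k + 1) ξ η) η := by
  have h := hasDerivAt_integral_mul_cexp (w := fun α => α) (by fun_prop) (by fun_prop)
    (fun α => rfl) (norm_gaussMoment_integrand_le i k ξ 0) η
  convert h using 1
  · ext s
    refine integral_congr_ae (ae_of_all _ fun α => ?_)
    have h1 : Complex.exp (-(‖α‖ ^ 2 : ℝ) + ξ * conj α + s * α) = Complex.exp (-(‖α‖ ^ 2 : ℝ) + ξ * conj α + 0 * α) * Complex.exp (s * α) := by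
      rw [← Complex.exp_add]; congr 1; ring
    simp only [h1]
    ring
  · refine integral_congr_ae (ae_of_all _ fun α => ?_)
    have h1 : Complex.exp (-(‖α‖ ^ 2 : ℝ) + ξ * conj α + η * α) = Complex.exp (-(‖α‖ ^ 2 : ℝ) + ξ * conj α + 0 * α) * Complex.exp (η * α) := by
      rw [← Complex.exp_add]; congr 1; ring
    simp only [h1]
    ring

theorem iteratedDeriv_gaussMoment_left (i k : ℕ) (η : ℂ) :
    iteratedDeriv i (fun ξ => gaussMoment 0 k ξ η) = fun ξ => gaussMoment i k ξ η := by
  induction i with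
  | zero => simp
  | succ i ih =>
    rw [iteratedDeriv_succ, ih]
    ext ξ
    exact (hasDerivAt_gaussMoment_left i k ξ η).deriv

theorem iteratedDeriv_gaussMoment_right (i k : ℕ) (ξ : ℂ) :
    iteratedDeriv k (fun η => gaussMoment i 0 ξ η) = fun η => gaussMoment i k ξ η := by
  induction k with
  | zero => simp
  | succ k ih =>
    rw [iteratedDeriv_succ, ih]
    ext η
    exact (hasDerivAt_gaussMoment_right i k ξ η).deriv

theorem gaussMoment_zero_left (k : ℕ) (ξ η : ℂ) :
    gaussMoment 0 k ξ η = Real.pi * (ξ ^ k * Complex.exp (ξ * η)) := by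
  have h0 : (fun η => gaussMoment 0 0 ξ η) = fun η => (Real.pi : ℂ) * Complex.exp (ξ * η) := by
    ext η
    simpa [gaussMoment] using integral_cexp_neg_sq_norm_add_complex ξ η
  have h1 := iteratedDeriv_gaussMoment_right 0 k ξ
  rw [h0] at h1
  rw [← congrFun h1 η, iteratedDeriv_const_mul_field, iteratedDeriv_cexp_const_mul]

/-- Each `ξ`-derivative brings down a factor `ᾱ`, so this is the `i`-th derivative of `π ξ^k exp(ξ
η)`, expanded by Leibniz. -/
theorem gaussMoment_eq (i k : ℕ) (ξ η : ℂ) :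
    gaussMoment i k ξ η = Real.pi * Complex.exp (ξ * η) * ∑ l ∈ Finset.range (i + 1),
      (i.choose l : ℂ) * (k.descFactorial l : ℂ) * ξ ^ (k - l) * η ^ (i - l) := by
  have h1 := iteratedDeriv_gaussMoment_left i k η
  simp_rw [gaussMoment_zero_left] at h1
  rw [← congrFun h1 ξ, iteratedDeriv_const_mul_field, iteratedDeriv_fun_mul (by fun_prop) (by fun_prop),
    Finset.mul_sum, Finset.mul_sum]
  refine Finset.sum_congr rfl fun l _ => ?_
  simp_rw [mul_comm _ η]
  rw [iteratedDeriv_cexp_const_mul]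
  simp
  ring

end GaussianMoments

/-! ### Coherent amplitudes, displacement operators and Husimi functions -/

namespace Bosonic

variable {D : ℕ}

/-- The unimodular character `α ↦ exp(∑ⱼ (ξⱼ ᾱⱼ - ξ̄ⱼ αⱼ))` of phase space. -/
noncomputable def phaseChar (ξ α : Fin D → ℂ) : ℂ :=
  Complex.exp (∑ j, (ξ j * conj (α j) - conj (ξ j) * α j))

theorem continuous_phaseChar (ξ : Fin D → ℂ) : Continuous (phaseChar ξ) := by
  unfold phaseChar
  fun_prop

theorem norm_phaseChar (ξ α : Fin D → ℂ) : ‖phaseChar ξ α‖ = 1 := by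
  rw [phaseChar, Complex.norm_exp, Real.exp_eq_one_iff, Complex.re_sum]
  refine Finset.sum_eq_zero fun j _ => ?_
  simp [mul_comm]

theorem coherent_eq_prod (α : Fin D → ℂ) (n : Occ D) :
    coherent α n = ∏ j, ((Real.exp (-‖α j‖ ^ 2 / 2) : ℝ) : ℂ) * (α j ^ n j / ((√((n j)! : ℝ) : ℝ) : ℂ)) := by
  rw [Finset.prod_mul_distrib, Finset.prod_div_distrib, coherent, occFactorial]
  congr 2
  · rw [← Complex.ofReal_prod, ← Real.exp_sum, ← Finset.sum_neg_distrib, Finset.sum_div]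
  · rw [← Complex.ofReal_prod]
    push_cast
    rw [Real.sqrt_prod _ (fun i _ => by positivity), Complex.ofReal_prod]

theorem continuous_coherent (n : Occ D) : Continuous fun α => coherent α n := by
  unfold coherent
  fun_prop

theorem sqrt_factorial_ne_zero (n : ℕ) : ((√(n ! : ℝ) : ℝ) : ℂ) ≠ 0 := by
  rw [Complex.ofReal_ne_zero]
  positivity

theorem sq_sqrt_factorial (n : ℕ) : ((√(n ! : ℝ) : ℝ) : ℂ) * ((√(n ! : ℝ) : ℝ) : ℂ) = (n ! : ℂ) := by
  rw [← Complex.ofReal_mul, Real.mul_self_sqrt (by positivity)]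
  simp

/-- With `η = -ξ̄`, the Leibniz sum for the Gaussian moment is, term by term, the sum over the
intermediate number state `l` in the normally ordered product. -/
theorem integral_coherent_phaseChar_single_mode (m n : ℕ) (ξ : ℂ) :
    ∫ α : ℂ, conj (((Real.exp (-‖α‖ ^ 2 / 2) : ℝ) : ℂ) * (α ^ m / ((√(m ! : ℝ) : ℝ) : ℂ))) *
      (((Real.exp (-‖α‖ ^ 2 / 2) : ℝ) : ℂ) * (α ^ n / ((√(n ! : ℝ) : ℝ) : ℂ))) *
        Complex.exp (ξ * conj α - conj ξ * α) =
    Real.pi * ((Real.exp (-‖ξ‖ ^ 2) : ℝ) : ℂ) * ∑ l ∈ Finset.range (m + 1),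
      (if l ≤ n then ((√((n ! : ℝ) / (l ! : ℝ)) : ℝ) : ℂ) * ξ ^ (n - l) / ((n - l)! : ℂ) else 0) *
      conj (if l ≤ m then
        ((√((m ! : ℝ) / (l ! : ℝ)) : ℝ) : ℂ) * (-ξ) ^ (m - l) / ((m - l)! : ℂ) else 0) := by
  have h1 : ∀ α : ℂ, conj (((Real.exp (-‖α‖ ^ 2 / 2) : ℝ) : ℂ) * (α ^ m / ((√(m ! : ℝ) : ℝ) : ℂ))) *
      (((Real.exp (-‖α‖ ^ 2 / 2) : ℝ) : ℂ) * (α ^ n / ((√(n ! : ℝ) : ℝ) : ℂ))) *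
        Complex.exp (ξ * conj α - conj ξ * α) =
      1 / (((√(m ! : ℝ) : ℝ) : ℂ) * ((√(n ! : ℝ) : ℝ) : ℂ)) * (conj α ^ m * α ^ n *
        Complex.exp (-(‖α‖ ^ 2 : ℝ) + ξ * conj α + -conj ξ * α)) := by
    intro α
    have h2 : Complex.exp (-(‖α‖ ^ 2 : ℝ) + ξ * conj α + -conj ξ * α) =
        ((Real.exp (-‖α‖ ^ 2 / 2) : ℝ) : ℂ) * ((Real.exp (-‖α‖ ^ 2 / 2) : ℝ) : ℂ) *
        Complex.exp (ξ * conj α - conj ξ * α) := by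
      rw [Complex.ofReal_exp, ← Complex.exp_add, ← Complex.exp_add]
      congr 1
      push_cast
      ring
    rw [h2]
    simp only [map_mul, map_div₀, map_pow, Complex.conj_ofReal]
    field_simp
  simp_rw [h1]
  rw [integral_const_mul]
  change _ * gaussMoment m n ξ (-conj ξ) = _
  rw [gaussMoment_eq]
  have h3 : Complex.exp (ξ * -conj ξ) = ((Real.exp (-‖ξ‖ ^ 2) : ℝ) : ℂ) := by
    rw [mul_neg, Complex.mul_conj', Complex.ofReal_exp]
    push_cast
    rfl
  rw [h3, mul_left_comm, Finset.mul_sum]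
  congr 1
  refine Finset.sum_congr rfl fun l hl => ?_
  have hlm : l ≤ m := by simpa [Nat.lt_succ_iff] using hl
  by_cases hln : l ≤ n
  · rw [if_pos hln, if_pos hlm, Nat.cast_choose ℂ hlm, Nat.descFactorial_eq_div hln,
      Nat.cast_div (Nat.factorial_dvd_factorial (Nat.sub_le _ _))
        (by exact_mod_cast Nat.factorial_ne_zero _)]
    rw [Real.sqrt_div (by positivity), Real.sqrt_div (by positivity)]
    simp only [map_mul, map_div₀, map_pow, map_neg, Complex.conj_ofReal, Complex.ofReal_div,
      map_natCast]
    have e1 := sqrt_factorial_ne_zero m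
    have e2 := sqrt_factorial_ne_zero n
    have e3 := sqrt_factorial_ne_zero l
    have f1 := sq_sqrt_factorial m
    have f2 := sq_sqrt_factorial n
    have f3 := sq_sqrt_factorial l
    have g1 : ((m - l)! : ℂ) ≠ 0 := by exact_mod_cast Nat.factorial_ne_zero _
    have g2 : ((n - l)! : ℂ) ≠ 0 := by exact_mod_cast Nat.factorial_ne_zero _
    rw [← f1, ← f2, ← f3]
    field_simp
  -- For `l > n` the falling factorial vanishes, matching the zero branch of the creation matrix
  -- element.
  · rw [if_neg hln, Nat.descFactorial_of_lt (by omega)]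
    simp

/-- Annihilation from `m` only reaches `l ≤ m`, so the sum over intermediate states runs over a
finite box and factors over the modes. -/
theorem opMul_expCreation (ξ : Fin D → ℂ) (n m : Occ D) :
    opMul (expCreation ξ) (expCreation (-ξ))ᴴ n m = ∏ j, ∑ l ∈ Finset.range (m j + 1),
      (if l ≤ n j then ((√(((n j)! : ℝ) / (l ! : ℝ)) : ℝ) : ℂ) * ξ j ^ (n j - l) /
        ((n j - l)! : ℂ) else 0) *
      conj (if l ≤ m j then ((√(((m j)! : ℝ) / (l ! : ℝ)) : ℝ) : ℂ) * (-ξ j) ^ (m j - l) /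
        ((m j - l)! : ℂ) else 0) := by
  rw [Finset.prod_univ_sum, opMul]
  rw [tsum_eq_sum (s := Fintype.piFinset fun j => Finset.range (m j + 1))]
  · refine Finset.sum_congr rfl fun l _ => ?_
    rw [Matrix.conjTranspose_apply, expCreation, expCreation, Finset.prod_mul_distrib]
    congr 1
    exact map_prod (starRingEnd ℂ) _ _
  · intro l hl
    obtain ⟨j, hj⟩ : ∃ j, ¬ l j ≤ m j := by
      by_contra! h
      exact hl (Fintype.mem_piFinset.2 fun j => Finset.mem_range.2 (Nat.lt_succ_of_le (h j)))
    rw [Matrix.conjTranspose_apply]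
    have : expCreation (-ξ) m l = 0 := Finset.prod_eq_zero (Finset.mem_univ j) (if_neg hj)
    rw [this, star_zero, mul_zero]

/-- Anti-normal ordering: integrating a character against `|α⟩⟨α|` yields the displacement operator
damped by `exp(-|ξ|²/2)`. This factor is the source of the `+ 1` in `V + 1`. -/
theorem integral_coherent_phaseChar (m n : Occ D) (ξ : Fin D → ℂ) :
    ∫ α : Fin D → ℂ, conj (coherent α m) * coherent α n * phaseChar ξ α =
      (Real.pi : ℂ) ^ D * ((Real.exp (-(∑ j, ‖ξ j‖ ^ 2) / 2) : ℝ) : ℂ) * displacement ξ n m := by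
  have h : ∀ α : Fin D → ℂ, conj (coherent α m) * coherent α n * phaseChar ξ α =
      ∏ j, (conj (((Real.exp (-‖α j‖ ^ 2 / 2) : ℝ) : ℂ) *
        (α j ^ m j / ((√((m j)! : ℝ) : ℝ) : ℂ))) *
      (((Real.exp (-‖α j‖ ^ 2 / 2) : ℝ) : ℂ) * (α j ^ n j / ((√((n j)! : ℝ) : ℝ) : ℂ))) *
        Complex.exp (ξ j * conj (α j) - conj (ξ j) * α j)) := by
    intro α
    rw [coherent_eq_prod, coherent_eq_prod, map_prod, phaseChar, Complex.exp_sum,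
      ← Finset.prod_mul_distrib, ← Finset.prod_mul_distrib]
  simp_rw [h]
  rw [integral_fintype_prod_volume_eq_prod (fun j (z : ℂ) =>
    conj (((Real.exp (-‖z‖ ^ 2 / 2) : ℝ) : ℂ) * (z ^ m j / ((√((m j)! : ℝ) : ℝ) : ℂ))) *
      (((Real.exp (-‖z‖ ^ 2 / 2) : ℝ) : ℂ) * (z ^ n j / ((√((n j)! : ℝ) : ℝ) : ℂ))) *
        Complex.exp (ξ j * conj z - conj (ξ j) * z))]
  simp_rw [integral_coherent_phaseChar_single_mode]
  rw [Finset.prod_mul_distrib, ← opMul_expCreation, Finset.prod_mul_distrib, Finset.prod_const,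
    Finset.card_univ, Fintype.card_fin, displacement, Matrix.smul_apply, smul_eq_mul, ← mul_assoc]
  congr 1
  rw [mul_assoc]
  congr 1
  rw [← Complex.ofReal_prod, ← Real.exp_sum, ← Complex.ofReal_mul, ← Real.exp_add,
    Finset.sum_neg_distrib]
  congr 2
  ring

theorem displacement_zero (n m : Occ D) : displacement (0 : Fin D → ℂ) n m = if n = m then 1 else 0 := by
  have h0 : opMul (expCreation (0 : Fin D → ℂ)) (expCreation (-0))ᴴ n m = if n = m then 1 else 0 := by
    have h1 : ∀ a b : Occ D, expCreation (0 : Fin D → ℂ) a b = if a = b then 1 else 0 := by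
      intro a b
      unfold expCreation
      split_ifs with hab
      · subst hab
        refine Finset.prod_eq_one fun j _ => ?_
        rw [if_pos le_rfl, div_self (by positivity)]
        simp
      · obtain ⟨j, hj⟩ := Function.ne_iff.1 hab
        refine Finset.prod_eq_zero (Finset.mem_univ j) ?_
        split_ifs with h
        · have : a j - b j ≠ 0 := by omega
          simp [this]
        · rfl
    unfold opMul
    rw [tsum_eq_single m]
    · simp [h1]
    · intro k hk
      simp [h1, hk.symm]
  simp only [displacement, Matrix.smul_apply, h0]
  simp

theorem integrable_conj_coherent_mul_coherent (m n : Occ D) :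
    Integrable fun α : Fin D → ℂ => conj (coherent α m) * coherent α n := by
  have h : ∀ α : Fin D → ℂ, conj (coherent α m) * coherent α n =
      ∏ j, (1 / (((√((m j)! : ℝ) : ℝ) : ℂ) * ((√((n j)! : ℝ) : ℝ) : ℂ)) *
        (conj (α j) ^ m j * α j ^ n j *
          Complex.exp (-(‖α j‖ ^ 2 : ℝ) + 0 * conj (α j) + 0 * α j))) := by
    intro α
    rw [coherent_eq_prod, coherent_eq_prod, map_prod, ← Finset.prod_mul_distrib]
    refine Finset.prod_congr rfl fun j _ => ?_
    have h2 : Complex.exp (-(‖α j‖ ^ 2 : ℝ) + 0 * conj (α j) + 0 * α j) =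
        ((Real.exp (-‖α j‖ ^ 2 / 2) : ℝ) : ℂ) * ((Real.exp (-‖α j‖ ^ 2 / 2) : ℝ) : ℂ) := by
      rw [Complex.ofReal_exp, ← Complex.exp_add]
      congr 1
      push_cast
      ring
    rw [h2]
    simp only [map_mul, map_div₀, map_pow, Complex.conj_ofReal]
    field_simp
  simp_rw [h]
  exact Integrable.fintype_prod (f := fun j (z : ℂ) =>
    (1 / (((√((m j)! : ℝ) : ℝ) : ℂ) * ((√((n j)! : ℝ) : ℝ) : ℂ)) *
        (conj z ^ m j * z ^ n j * Complex.exp (-(‖z‖ ^ 2 : ℝ) + 0 * conj z + 0 * z))))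
    fun j => (integrable_gaussMoment _ _ 0 0).const_mul _

/-- The coherent amplitudes, normalized in `L²(ℂ^D)`. -/
noncomputable def coherentFun (n : Occ D) (α : Fin D → ℂ) : ℂ :=
  coherent α n / ((√(Real.pi ^ D) : ℝ) : ℂ)

theorem conj_coherentFun_mul (m n : Occ D) (α : Fin D → ℂ) :
    conj (coherentFun m α) * coherentFun n α =
      conj (coherent α m) * coherent α n / (Real.pi : ℂ) ^ D := by
  have : ((√(Real.pi ^ D) : ℝ) : ℂ) * ((√(Real.pi ^ D) : ℝ) : ℂ) = (Real.pi : ℂ) ^ D := by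
    rw [← Complex.ofReal_mul, Real.mul_self_sqrt (by positivity)]
    simp
  rw [coherentFun, coherentFun, map_div₀, Complex.conj_ofReal, div_mul_div_comm, this]

theorem integral_coherentFun_phaseChar (m n : Occ D) (ξ : Fin D → ℂ) :
    ∫ α : Fin D → ℂ, conj (coherentFun m α) * coherentFun n α * phaseChar ξ α =
      ((Real.exp (-(∑ j, ‖ξ j‖ ^ 2) / 2) : ℝ) : ℂ) * displacement ξ n m := by
  have h := integral_coherent_phaseChar m n ξ
  have hpi : (Real.pi : ℂ) ^ D ≠ 0 := pow_ne_zero _ (by exact_mod_cast Real.pi_ne_zero)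
  simp_rw [conj_coherentFun_mul, div_mul_eq_mul_div]
  rw [integral_div, h]
  field_simp

/-- The case `ξ = 0` of the integral above, where the displacement operator is the identity. -/
theorem isL2Orthonormal_coherentFun :
    IsL2Orthonormal (volume : Measure (Fin D → ℂ)) (coherentFun (D := D)) := by
  have hc : ∀ n : Occ D, Continuous (coherentFun n) := fun n =>
    (continuous_coherent n).div_const _
  have h0 : ∀ m n : Occ D, ∫ α : Fin D → ℂ, conj (coherentFun m α) * coherentFun n α =
      if n = m then 1 else 0 := by
    intro m n
    have h := integral_coherentFun_phaseChar m n 0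
    rw [displacement_zero] at h
    simpa [phaseChar] using h
  refine ⟨fun i => ?_, fun i => by rw [h0, if_pos rfl], fun i j hij => by rw [h0, if_neg hij.symm]⟩
  rw [memLp_two_iff_integrable_sq_norm (hc i).aestronglyMeasurable]
  have := ((integrable_conj_coherent_mul_coherent i i).div_const ((Real.pi : ℂ) ^ D)).re
  refine this.congr (ae_of_all _ fun α => ?_)
  simp only []
  rw [← conj_coherentFun_mul, Complex.conj_mul']
  norm_cast

/-- A finite set of multi-indices lies in the box of its coordinate projections, on which the sum
factors. -/
theorem summable_prod_of_nonneg {f : Fin D → ℕ → ℝ} (h0 : ∀ j n, 0 ≤ f j n)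
    (hs : ∀ j, Summable (f j)) : Summable fun n : Occ D => ∏ j, f j (n j) := by
  refine summable_of_sum_le (c := ∏ j, ∑' n, f j n)
    (fun n => Finset.prod_nonneg fun j _ => h0 j _) fun s => ?_
  calc ∑ n ∈ s, ∏ j, f j (n j)
      ≤ ∑ n ∈ Fintype.piFinset fun j => s.image fun n => n j, ∏ j, f j (n j) :=
        Finset.sum_le_sum_of_subset_of_nonneg
          (fun n hn => Fintype.mem_piFinset.2 fun j => Finset.mem_image_of_mem _ hn)
          (fun n _ _ => Finset.prod_nonneg fun j _ => h0 j _)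
    _ = ∏ j, ∑ n ∈ s.image fun n => n j, f j n := (Finset.prod_univ_sum _ _).symm
    _ ≤ ∏ j, ∑' n, f j n := Finset.prod_le_prod
        (fun j _ => Finset.sum_nonneg fun n _ => h0 j n)
        (fun j _ => (hs j).sum_le_tsum _ fun n _ => h0 j n)

theorem summable_sq_norm_coherent (α : Fin D → ℂ) : Summable fun n : Occ D => ‖coherent α n‖ ^ 2 := by
  have h1 : ∀ z : ℂ, Summable fun n : ℕ => Real.exp (-‖z‖ ^ 2) * ((‖z‖ ^ 2) ^ n / n !) :=
    fun z => (Real.summable_pow_div_factorial _).mul_left _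
  refine (summable_prod_of_nonneg (fun j n => by positivity) fun j => h1 (α j)).congr fun n => ?_
  rw [coherent_eq_prod, norm_prod, ← Finset.prod_pow]
  refine Finset.prod_congr rfl fun j _ => ?_
  rw [norm_mul, norm_div, norm_pow, Complex.norm_real, Complex.norm_real, Real.norm_eq_abs,
    Real.norm_eq_abs, Real.abs_exp, abs_of_nonneg (Real.sqrt_nonneg _), mul_pow, div_pow,
    Real.sq_sqrt (by positivity), ← Real.exp_nat_mul]
  congr 2
  · push_cast; ring
  · ring

theorem summable_sq_norm_coherentFun (α : Fin D → ℂ) :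
    Summable fun n : Occ D => ‖coherentFun n α‖ ^ 2 := by
  simp_rw [coherentFun, norm_div, div_pow]
  exact (summable_sq_norm_coherent α).div_const _

theorem quadForm_coherentFun (ρ : Matrix (Occ D) (Occ D) ℂ) (α : Fin D → ℂ) :
    quadForm ρ (fun n => coherentFun n α) = quadForm ρ (coherent α) / (Real.pi : ℂ) ^ D := by
  unfold quadForm
  rw [← tsum_div_const]
  refine tsum_congr fun m => ?_
  rw [← tsum_div_const]
  refine tsum_congr fun n => ?_
  rw [mul_right_comm, conj_coherentFun_mul]
  ring

theorem IsDensity.summable_diag {ρ : Matrix (Occ D) (Occ D) ℂ} (h : IsDensity ρ) :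
    Summable fun n => ρ n n := h.2.summable

/-- Positivity makes the quadratic form real, so the real part taken in `husimi` loses nothing. -/
theorem IsDensity.quadForm_eq_husimi {ρ : Matrix (Occ D) (Occ D) ℂ} (h : IsDensity ρ)
    (α : Fin D → ℂ) : quadForm ρ (fun n => coherentFun n α) = (husimi ρ α : ℂ) := by
  have h0 := h.1.quadForm_nonneg h.summable_diag (summable_sq_norm_coherent α)
  rw [quadForm_coherentFun, husimi]
  push_cast
  congr 1
  change _ = ((quadForm ρ (coherent α)).re : ℂ)
  rw [Complex.nonneg_iff] at h0
  apply Complex.ext <;> simp [← h0.2]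

theorem IsDensity.husimi_nonneg {ρ : Matrix (Occ D) (Occ D) ℂ} (h : IsDensity ρ)
    (α : Fin D → ℂ) : 0 ≤ husimi ρ α := by
  have h0 := h.1.quadForm_nonneg h.summable_diag (summable_sq_norm_coherentFun α)
  rwa [h.quadForm_eq_husimi, Complex.zero_le_real] at h0

theorem IsDensity.integrable_husimi {ρ : Matrix (Occ D) (Occ D) ℂ} (h : IsDensity ρ) :
    Integrable (husimi ρ) := by
  have := (isL2Orthonormal_coherentFun.trace_formula summable_sq_norm_coherentFun h.1
    h.summable_diag (measurable_const (a := (1 : ℂ))) (fun _ => norm_one)).1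
  simp_rw [h.quadForm_eq_husimi] at this
  simpa using this.re

/-- The Fourier transform of the Husimi function is the anti-normally ordered characteristic
function. -/
theorem IsDensity.integral_husimi_phaseChar {ρ : Matrix (Occ D) (Occ D) ℂ} (h : IsDensity ρ)
    (ξ : Fin D → ℂ) :
    ∫ α, (husimi ρ α : ℂ) * phaseChar ξ α =
      ((Real.exp (-(∑ j, ‖ξ j‖ ^ 2) / 2) : ℝ) : ℂ) * charFn ρ ξ := by
  have h1 := (isL2Orthonormal_coherentFun.trace_formula summable_sq_norm_coherentFun h.1
    h.summable_diag (continuous_phaseChar ξ).measurable (norm_phaseChar ξ)).2.2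
  simp_rw [h.quadForm_eq_husimi] at h1
  rw [← h1.tsum_eq, charFn, opTrace, ← tsum_mul_left]
  refine tsum_congr fun i => ?_
  rw [opMul, ← tsum_mul_left]
  refine tsum_congr fun k => ?_
  rw [integral_coherentFun_phaseChar]
  ring

end Bosonic

/-! ### Kronecker products of positive semidefinite matrices -/

section Gram

variable {ι κ H : Type} [NormedAddCommGroup H] [InnerProductSpace ℂ H]

theorem Matrix.PosSemidef.of_gram {M : Matrix ι ι ℂ} {v : ι → H}
    (hM : ∀ i j, M i j = inner ℂ (v i) (v j)) : M.PosSemidef := by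
  refine ⟨Matrix.IsHermitian.ext fun i j => ?_, fun x => ?_⟩
  · rw [hM, hM]
    exact inner_conj_symm _ _
  · have : (x.sum fun i xi => x.sum fun j xj => star xi * M i j * xj) =
        inner ℂ (x.sum fun i xi => xi • v i) (x.sum fun i xi => xi • v i) := by
      rw [Finsupp.sum_inner]
      refine Finsupp.sum_congr fun i _ => ?_
      rw [Finsupp.inner_sum]
      refine Finsupp.sum_congr fun j _ => ?_
      rw [inner_smul_left, inner_smul_right, hM, RCLike.star_def]
      ring
    have h0 := norm_nonneg (x.sum fun i xi => xi • v i)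
    rw [this, inner_self_eq_norm_sq_to_K]
    exact pow_nonneg (Complex.zero_le_real.2 h0) 2

/-- The Gram vectors are the tensors `v i ⊗ w k`. -/
theorem Matrix.PosSemidef.kronecker_infinite {A : Matrix ι ι ℂ} {B : Matrix κ κ ℂ}
    (hA : A.PosSemidef) (hB : B.PosSemidef) : (A ⊗ₖ B).PosSemidef := by
  obtain ⟨H, i1, i2, i3, v, hv⟩ := hA.exists_gram
  obtain ⟨K, j1, j2, j3, w, hw⟩ := hB.exists_gram
  refine Matrix.PosSemidef.of_gram (v := fun i : ι × κ => TensorProduct.tmul ℂ (v i.1) (w i.2))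
    fun i j => ?_
  rw [TensorProduct.inner_tmul, Matrix.kroneckerMap_apply, hv, hw]

/-- The forms are iterated sums, so the product rule for series is used twice. It needs absolute
summability of each inner series and of the outer series of inner sums, which `key` derives from
Gram vectors. -/
theorem Matrix.PosSemidef.quadForm_kronecker {A : Matrix ι ι ℂ} {B : Matrix κ κ ℂ}
    (hA : A.PosSemidef) (hB : B.PosSemidef) (hAs : Summable fun i => A i i)
    (hBs : Summable fun i => B i i) {c : ι → ℂ} {d : κ → ℂ} (hc : Summable fun i => ‖c i‖ ^ 2)
    (hd : Summable fun i => ‖d i‖ ^ 2) :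
    quadForm (A ⊗ₖ B) (fun i => c i.1 * d i.2) = quadForm A c * quadForm B d := by
  have key : ∀ {ι : Type} {A : Matrix ι ι ℂ} {c : ι → ℂ}, A.PosSemidef →
      (Summable fun i => A i i) → (Summable fun i => ‖c i‖ ^ 2) →
      (∀ i, Summable fun j => ‖conj (c i) * A i j * c j‖) ∧
      Summable fun i => ‖∑' j, conj (c i) * A i j * c j‖ := by
    intro ι A c hA hAs hc
    obtain ⟨H, i1, i2, i3, v, hv, hs⟩ := hA.exists_gram_summable hAs
    have h1 := summable_norm_smul hc hs
    have h2 : ∀ i j, conj (c i) * A i j * c j = inner ℂ (c i • v i) (c j • v j) := by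
      intro i j
      rw [inner_smul_left, inner_smul_right, hv]
      ring
    simp_rw [h2]
    refine ⟨fun i => (h1.mul_left ‖c i • v i‖).of_nonneg_of_le (fun _ => norm_nonneg _)
      fun j => norm_inner_le_norm _ _, ?_⟩
    refine (h1.mul_right ‖∑' j, c j • v j‖).of_nonneg_of_le (fun _ => norm_nonneg _) fun i => ?_
    simp_rw [← innerSL_apply_apply ℂ (c i • v i)]
    rw [← (innerSL ℂ _).map_tsum h1.of_norm, innerSL_apply_apply]
    exact norm_inner_le_norm _ _
  obtain ⟨a1, a2⟩ := key hA hAs hc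
  obtain ⟨b1, b2⟩ := key hB hBs hd
  unfold quadForm
  rw [tsum_mul_tsum_of_summable_norm a2 b2]
  refine tsum_congr fun i => ?_
  rw [tsum_mul_tsum_of_summable_norm (a1 i.1) (b1 i.2)]
  refine tsum_congr fun j => ?_
  rw [map_mul, Matrix.kroneckerMap_apply]
  ring

end Gram

/-! ### Conjugation by a unitary that preserves finite blocks -/

open Bosonic

/-- A matrix which preserves an exhausting filtration of the index set by finite sets and is
unitary on each of them. -/
structure IsGradedUnitary {ι : Type} (U : Matrix ι ι ℂ) (S : ℕ → Finset ι) : Prop where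
  mono : Monotone S
  exhaust : ∀ i, ∃ n, i ∈ S n
  mem_iff : ∀ o a, U o a ≠ 0 → ∀ n, o ∈ S n ↔ a ∈ S n
  isometry_self : ∀ n, ∀ a ∈ S n, ∑ o ∈ S n, U o a * conj (U o a) = 1
  isometry_ne : ∀ n, ∀ a ∈ S n, ∀ b ∈ S n, a ≠ b → ∑ o ∈ S n, U o a * conj (U o b) = 0

namespace IsGradedUnitary

variable {ι H : Type} [NormedAddCommGroup H] [InnerProductSpace ℂ H]
  {U : Matrix ι ι ℂ} {S : ℕ → Finset ι}

theorem tendsto (h : IsGradedUnitary U S) : Filter.Tendsto S Filter.atTop Filter.atTop :=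
  Filter.tendsto_atTop_finset_of_monotone h.mono h.exhaust

theorem eq_zero (h : IsGradedUnitary U S) {o a : ι} {n : ℕ} (ho : o ∈ S n) (ha : a ∉ S n) :
    U o a = 0 := by
  by_contra h0
  exact ha ((h.mem_iff o a h0 n).1 ho)

theorem eq_zero' (h : IsGradedUnitary U S) {o a : ι} {n : ℕ} (ho : o ∉ S n) (ha : a ∈ S n) :
    U o a = 0 := by
  by_contra h0
  exact ho ((h.mem_iff o a h0 n).2 ha)

/-- Gram vectors of `U R Uᴴ`, for Gram vectors `w` of `R`. -/
noncomputable def gramVec (U : Matrix ι ι ℂ) (w : ι → H) (o : ι) : H := ∑' a, conj (U o a) • w a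

theorem gramVec_eq (h : IsGradedUnitary U S) (w : ι → H) {o : ι} {n : ℕ} (ho : o ∈ S n) :
    gramVec U w o = ∑ a ∈ S n, conj (U o a) • w a :=
  tsum_eq_sum fun a ha => by rw [h.eq_zero ho ha, map_zero, zero_smul]

/-- Each row of `U` is supported in a finite block, so both matrix products are finite sums. -/
theorem opMul_eq (h : IsGradedUnitary U S) {R : Matrix ι ι ℂ} {w : ι → H}
    (hR : ∀ i j, R i j = inner ℂ (w i) (w j)) (o o' : ι) :
    opMul (opMul U R) Uᴴ o o' = inner ℂ (gramVec U w o) (gramVec U w o') := by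
  obtain ⟨n, hn⟩ := h.exhaust o
  obtain ⟨m, hm⟩ := h.exhaust o'
  rw [h.gramVec_eq w hn, h.gramVec_eq w hm, inner_sum]
  unfold opMul
  rw [tsum_eq_sum (s := S m) fun b hb => by
    rw [Matrix.conjTranspose_apply, h.eq_zero hm hb, star_zero, mul_zero]]
  refine Finset.sum_congr rfl fun b _ => ?_
  rw [tsum_eq_sum (s := S n) fun a ha => by rw [h.eq_zero hn ha, zero_mul], sum_inner,
    Finset.sum_mul]
  refine Finset.sum_congr rfl fun a _ => ?_
  rw [inner_smul_left, inner_smul_right, hR, Matrix.conjTranspose_apply, RCLike.star_def,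
    RCLike.conj_conj]
  ring

theorem sum_norm_sq_gramVec (h : IsGradedUnitary U S) (w : ι → H) (n : ℕ) :
    ∑ o ∈ S n, ‖gramVec U w o‖ ^ 2 = ∑ a ∈ S n, ‖w a‖ ^ 2 := by
  have h1 : ∑ o ∈ S n, inner ℂ (gramVec U w o) (gramVec U w o) =
      ∑ a ∈ S n, inner ℂ (w a) (w a) := by
    calc ∑ o ∈ S n, inner ℂ (gramVec U w o) (gramVec U w o)
        = ∑ o ∈ S n, ∑ a ∈ S n, ∑ b ∈ S n, (U o a * conj (U o b)) * inner ℂ (w a) (w b) := by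
          refine Finset.sum_congr rfl fun o ho => ?_
          rw [h.gramVec_eq w ho, sum_inner]
          refine Finset.sum_congr rfl fun a _ => ?_
          rw [inner_sum]
          refine Finset.sum_congr rfl fun b _ => ?_
          rw [inner_smul_left, inner_smul_right, RCLike.conj_conj]
          ring
      _ = ∑ a ∈ S n, ∑ b ∈ S n, (∑ o ∈ S n, U o a * conj (U o b)) * inner ℂ (w a) (w b) := by
          rw [Finset.sum_comm]
          refine Finset.sum_congr rfl fun a _ => ?_
          rw [Finset.sum_comm]
          refine Finset.sum_congr rfl fun b _ => ?_
          rw [Finset.sum_mul]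
      _ = ∑ a ∈ S n, inner ℂ (w a) (w a) := by
          refine Finset.sum_congr rfl fun a ha => ?_
          rw [Finset.sum_eq_single a]
          · rw [h.isometry_self n a ha, one_mul]
          · intro b hb hba
            rw [h.isometry_ne n a ha b hb hba.symm, zero_mul]
          · exact fun h => absurd ha h
  simp_rw [inner_self_eq_norm_sq_to_K] at h1
  exact_mod_cast h1

/-- Trace preservation: the sums over each block `S n` agree exactly, and the blocks exhaust the
index set. -/
theorem hasSum_norm_sq_gramVec (h : IsGradedUnitary U S) {w : ι → H} {t : ℝ}
    (hw : HasSum (fun a => ‖w a‖ ^ 2) t) : HasSum (fun o => ‖gramVec U w o‖ ^ 2) t := by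
  have hsum : Summable fun o => ‖gramVec U w o‖ ^ 2 := by
    refine summable_of_sum_le (c := t) (fun o => sq_nonneg _) fun F => ?_
    obtain ⟨n, hn⟩ := (h.tendsto.eventually (Filter.eventually_ge_atTop F)).exists
    calc ∑ o ∈ F, ‖gramVec U w o‖ ^ 2 ≤ ∑ o ∈ S n, ‖gramVec U w o‖ ^ 2 :=
          Finset.sum_le_sum_of_subset_of_nonneg hn fun _ _ _ => sq_nonneg _
      _ = ∑ a ∈ S n, ‖w a‖ ^ 2 := h.sum_norm_sq_gramVec w n
      _ ≤ t := sum_le_hasSum _ (fun _ _ => sq_nonneg _) hw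
  have h1 := hsum.hasSum
  have h2 := h1
  have h3 := hw
  rw [HasSum, SummationFilter.unconditional_filter] at h2 h3
  have h4 := h2.comp h.tendsto
  have h5 := h3.comp h.tendsto
  simp only [Function.comp_def, h.sum_norm_sq_gramVec] at h4 h5
  rwa [tendsto_nhds_unique h4 h5] at h1

theorem tsum_smul_gramVec [CompleteSpace H] (h : IsGradedUnitary U S) {w : ι → H}
    (hw : Summable fun a => ‖w a‖ ^ 2) {c d : ι → ℂ} (hc : Summable fun a => ‖c a‖ ^ 2)
    (hd : Summable fun a => ‖d a‖ ^ 2) (hcd : ∀ a, d a = ∑' o, conj (U o a) * c o) :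
    ∑' o, c o • gramVec U w o = ∑' a, d a • w a := by
  have h2 := (summable_norm_smul hc (h.hasSum_norm_sq_gramVec hw.hasSum).summable).of_norm.hasSum
  have h3 := (summable_norm_smul hd hw).of_norm.hasSum
  rw [HasSum, SummationFilter.unconditional_filter] at h2 h3
  refine tendsto_nhds_unique (h2.comp h.tendsto) ((h3.comp h.tendsto).congr fun n => ?_)
  simp only [Function.comp_def]
  calc ∑ a ∈ S n, d a • w a = ∑ a ∈ S n, ∑ o ∈ S n, (conj (U o a) * c o) • w a := by
        refine Finset.sum_congr rfl fun a ha => ?_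
        rw [hcd, tsum_eq_sum (s := S n) fun o ho => by rw [h.eq_zero' ho ha, map_zero, zero_mul],
          Finset.sum_smul]
    _ = ∑ o ∈ S n, c o • gramVec U w o := by
        rw [Finset.sum_comm]
        refine Finset.sum_congr rfl fun o ho => ?_
        rw [h.gramVec_eq w ho, Finset.smul_sum]
        refine Finset.sum_congr rfl fun a _ => ?_
        rw [smul_smul, mul_comm]

/-- In the last clause `d = U† c`; both forms are squared norms of the same vector, by
`tsum_smul_gramVec`. -/
theorem conj_density (h : IsGradedUnitary U S) {R : Matrix ι ι ℂ} (hR : R.PosSemidef) {t : ℝ}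
    (ht : HasSum (fun i => R i i) (t : ℂ)) :
    (opMul (opMul U R) Uᴴ).PosSemidef ∧ HasSum (fun i => opMul (opMul U R) Uᴴ i i) (t : ℂ) ∧
    ∀ c d : ι → ℂ, (Summable fun a => ‖c a‖ ^ 2) → (Summable fun a => ‖d a‖ ^ 2) →
      (∀ a, d a = ∑' o, conj (U o a) * c o) →
      quadForm (opMul (opMul U R) Uᴴ) c = quadForm R d := by
  obtain ⟨H, i1, i2, i3, w, hw, hs⟩ := hR.exists_gram_summable ht.summable
  have hw1 : ∀ a, R a a = ((‖w a‖ ^ 2 : ℝ) : ℂ) := fun a => by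
    rw [hw, inner_self_eq_norm_sq_to_K]; simp
  have hg1 : ∀ a, opMul (opMul U R) Uᴴ a a = ((‖gramVec U w a‖ ^ 2 : ℝ) : ℂ) := fun a => by
    rw [h.opMul_eq hw, inner_self_eq_norm_sq_to_K]; simp
  simp_rw [hw1] at ht
  have ht' := h.hasSum_norm_sq_gramVec (Complex.hasSum_ofReal.1 ht)
  refine ⟨Matrix.PosSemidef.of_gram (h.opMul_eq hw), ?_, fun c d hc hd hcd => ?_⟩
  · simp_rw [hg1]
    exact Complex.hasSum_ofReal.2 ht'
  · rw [quadForm_eq_ofReal hw hs hd, quadForm_eq_ofReal (h.opMul_eq hw) ht'.summable hc,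
      h.tsum_smul_gramVec hs hc hd hcd]

end IsGradedUnitary

theorem IsL2Orthonormal.prod {ι κ X Y : Type} [MeasurableSpace X] [MeasurableSpace Y]
    {μ : Measure X} {ν : Measure Y} [SFinite μ] [SFinite ν] {e : ι → X → ℂ} {f : κ → Y → ℂ}
    (he : IsL2Orthonormal μ e) (hf : IsL2Orthonormal ν f) :
    IsL2Orthonormal (μ.prod ν) (fun (n : ι × κ) (z : X × Y) => e n.1 z.1 * f n.2 z.2) := by
  have key : ∀ m n : ι × κ, ∫ z : X × Y, conj (e m.1 z.1 * f m.2 z.2) * (e n.1 z.1 * f n.2 z.2)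
      ∂(μ.prod ν) = (∫ x, conj (e m.1 x) * e n.1 x ∂μ) * ∫ y, conj (f m.2 y) * f n.2 y ∂ν := by
    intro m n
    rw [← integral_prod_mul (fun x => conj (e m.1 x) * e n.1 x)
      (fun y => conj (f m.2 y) * f n.2 y)]
    refine integral_congr_ae (ae_of_all _ fun z => ?_)
    simp only [map_mul]
    ring
  refine ⟨fun n => ?_, fun n => ?_, fun m n hmn => ?_⟩
  · have hm : AEStronglyMeasurable (fun z : X × Y => e n.1 z.1 * f n.2 z.2) (μ.prod ν) :=
      (he.memLp n.1).1.comp_fst.mul (hf.memLp n.2).1.comp_snd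
    rw [memLp_two_iff_integrable_sq_norm hm]
    refine (((memLp_two_iff_integrable_sq_norm (he.memLp n.1).1).1 (he.memLp n.1)).mul_prod
      ((memLp_two_iff_integrable_sq_norm (hf.memLp n.2).1).1 (hf.memLp n.2))).congr
      (ae_of_all _ fun z => ?_)
    simp only [norm_mul, mul_pow]
  · rw [key, he.integral_eq_one, hf.integral_eq_one, one_mul]
  · rw [key]
    by_cases h1 : m.1 = n.1
    · have h2 : m.2 ≠ n.2 := fun h2 => hmn (Prod.ext h1 h2)
      rw [hf.integral_eq_zero _ _ h2, mul_zero]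
    · rw [he.integral_eq_zero _ _ h1, zero_mul]

/-! ### The beam splitter as a rotation of phase space -/

namespace Bosonic

variable {D : ℕ}

/-- The rotation of the joint phase space of the two inputs of a beam splitter. -/
noncomputable def bsRotation (D : ℕ) (s t : ℝ) :
    ((Fin D → ℂ) × (Fin D → ℂ)) →ₗ[ℝ] ((Fin D → ℂ) × (Fin D → ℂ)) where
  toFun z := (s • z.1 - t • z.2, t • z.1 + s • z.2)
  map_add' z w := by
    ext j <;> simp <;> ring
  map_smul' c z := by
    ext j <;> simp <;> ring

theorem bsRotation_apply (s t : ℝ) (z : (Fin D → ℂ) × (Fin D → ℂ)) :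
    bsRotation D s t z = (s • z.1 - t • z.2, t • z.1 + s • z.2) := rfl

theorem bsRotation_comp (s t : ℝ) (h : s ^ 2 + t ^ 2 = 1) :
    bsRotation D s t ∘ₗ bsRotation D s (-t) = LinearMap.id := by
  have h' : (s : ℂ) ^ 2 + (t : ℂ) ^ 2 = 1 := by exact_mod_cast h
  refine LinearMap.ext fun z => Prod.ext (funext fun j => ?_) (funext fun j => ?_)
  · simp [bsRotation_apply]
    linear_combination (z.1 j) * h'
  · simp [bsRotation_apply]
    linear_combination (z.2 j) * h'

theorem bsRotation_bsRotation_neg (s t : ℝ) (h : s ^ 2 + t ^ 2 = 1)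
    (z : (Fin D → ℂ) × (Fin D → ℂ)) : bsRotation D s t (bsRotation D s (-t) z) = z := by
  simpa using congrArg (fun f => f z) (bsRotation_comp (D := D) s t h)

theorem abs_det_bsRotation (s t : ℝ) (h : s ^ 2 + t ^ 2 = 1) :
    |LinearMap.det (bsRotation D s t)| = 1 := by
  -- The reflection `(z₁, z₂) ↦ (z₁, -z₂)` conjugates the rotation into its inverse. Both have the
  -- same determinant, with product one.
  let F : ((Fin D → ℂ) × (Fin D → ℂ)) →ₗ[ℝ] ((Fin D → ℂ) × (Fin D → ℂ)) :=
    LinearMap.prodMap LinearMap.id (-LinearMap.id)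
  have hF : F ∘ₗ F = LinearMap.id := by
    ext z j <;> simp [F]
  have hc : bsRotation D s (-t) = F ∘ₗ bsRotation D s t ∘ₗ F := by
    ext z j <;> simp [F, bsRotation_apply]
  have h1 := congrArg LinearMap.det hF
  have h2 := congrArg LinearMap.det (bsRotation_comp (D := D) s t h)
  rw [LinearMap.det_comp, LinearMap.det_id] at h1 h2
  rw [hc, LinearMap.det_comp, LinearMap.det_comp] at h2
  rw [abs_eq zero_le_one]
  refine mul_self_eq_one_iff.1 ?_
  linear_combination h2 - LinearMap.det (bsRotation D s t) ^ 2 * h1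

theorem measurePreserving_bsRotation (s t : ℝ) (h : s ^ 2 + t ^ 2 = 1) :
    MeasurePreserving (bsRotation D s t)
      (volume : Measure ((Fin D → ℂ) × (Fin D → ℂ))) volume := by
  have hd := abs_det_bsRotation (D := D) s t h
  have hd0 : LinearMap.det (bsRotation D s t) ≠ 0 := by
    intro h0
    rw [h0] at hd
    simp at hd
  have : (volume : Measure ((Fin D → ℂ) × (Fin D → ℂ))).IsAddHaarMeasure := by
    have : (volume : Measure (Fin D → ℂ)).IsAddHaarMeasure := Measure.pi.isAddHaarMeasure _
    exact Measure.prod.instIsAddHaarMeasure _ _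
  refine ⟨(LinearMap.continuous_of_finiteDimensional _).measurable, ?_⟩
  rw [Measure.map_linearMap_addHaar_eq_smul_addHaar _ hd0, abs_inv, hd]
  simp

theorem measurableEmbedding_bsRotation (s t : ℝ) (h : s ^ 2 + t ^ 2 = 1) :
    MeasurableEmbedding (bsRotation D s t) := by
  have h' : s ^ 2 + (-t) ^ 2 = 1 := by rw [neg_sq]; exact h
  let e : ((Fin D → ℂ) × (Fin D → ℂ)) ≃ₗ[ℝ] ((Fin D → ℂ) × (Fin D → ℂ)) := .ofLinearMap (bsRotation D s t) (bsRotation D s (-t))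
    (bsRotation_comp s t h)
    (by simpa using bsRotation_comp (D := D) s (-t) h')
  exact e.toContinuousLinearEquiv.toHomeomorph.measurableEmbedding

theorem integral_comp_bsRotation (s t : ℝ) (h : s ^ 2 + t ^ 2 = 1)
    (g : (Fin D → ℂ) × (Fin D → ℂ) → ℂ) : ∫ z, g (bsRotation D s t z) = ∫ z, g z :=
  (measurePreserving_bsRotation s t h).integral_comp (measurableEmbedding_bsRotation s t h) g

/-- The polynomial in the creation operators which the beam splitter applies to the vacuum. -/
noncomputable def bsPoly (τ : ℝ) (inp : Occ D × Occ D) : MvPolynomial (Fin D ⊕ Fin D) ℂ :=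
  ∏ j : Fin D,
    ((MvPolynomial.C ((Real.sqrt τ : ℝ) : ℂ) * MvPolynomial.X (Sum.inl j)
        - MvPolynomial.C ((Real.sqrt (1 - τ) : ℝ) : ℂ) * MvPolynomial.X (Sum.inr j)) ^ inp.1 j *
      (MvPolynomial.C ((Real.sqrt (1 - τ) : ℝ) : ℂ) * MvPolynomial.X (Sum.inl j)
        + MvPolynomial.C ((Real.sqrt τ : ℝ) : ℂ) * MvPolynomial.X (Sum.inr j)) ^ inp.2 j)

/-- Joint occupation numbers as exponents of monomials. -/
noncomputable def occExponent : Occ D × Occ D ≃ (Fin D ⊕ Fin D →₀ ℕ) :=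
  (Equiv.sumArrowEquivProdArrow _ _ _).symm.trans Finsupp.equivFunOnFinite.symm

theorem occExponent_inl (n : Occ D × Occ D) (j : Fin D) : occExponent n (Sum.inl j) = n.1 j := rfl

theorem occExponent_inr (n : Occ D × Occ D) (j : Fin D) : occExponent n (Sum.inr j) = n.2 j := rfl

/-- The total number of photons. -/
def occDegree (n : Occ D × Occ D) : ℕ := ∑ j, n.1 j + ∑ j, n.2 j

theorem degree_occExponent (n : Occ D × Occ D) : (occExponent n).degree = occDegree n := by
  rw [Finsupp.degree_eq_sum, Fintype.sum_sum_type]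
  rfl

theorem isHomogeneous_bsPoly (τ : ℝ) (inp : Occ D × Occ D) :
    (bsPoly τ inp).IsHomogeneous (occDegree inp) := by
  have hl : ∀ (c : ℂ) (i : Fin D ⊕ Fin D),
      (MvPolynomial.C c * MvPolynomial.X i : MvPolynomial (Fin D ⊕ Fin D) ℂ).IsHomogeneous 1 :=
    fun c i => MvPolynomial.isHomogeneous_C_mul_X c i
  rw [occDegree, ← Finset.sum_add_distrib]
  refine MvPolynomial.IsHomogeneous.prod _ _ _ fun j _ => ?_
  refine MvPolynomial.IsHomogeneous.mul ?_ ?_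
  · simpa using ((hl _ _).sub (hl _ _)).pow (inp.1 j)
  · simpa using ((hl _ _).add (hl _ _)).pow (inp.2 j)

theorem map_conj_bsPoly (τ : ℝ) (inp : Occ D × Occ D) :
    MvPolynomial.map (starRingEnd ℂ) (bsPoly τ inp) = bsPoly τ inp := by
  simp [bsPoly, map_prod]

theorem beamSplitterU_apply (τ : ℝ) (out inp : Occ D × Occ D) :
    beamSplitterU τ out inp = ((√(((occFactorial out.1 * occFactorial out.2 : ℕ) : ℝ) /
      ((occFactorial inp.1 * occFactorial inp.2 : ℕ) : ℝ)) : ℝ) : ℂ) *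
      MvPolynomial.coeff (occExponent out) (bsPoly τ inp) := rfl

theorem conj_beamSplitterU (τ : ℝ) (out inp : Occ D × Occ D) :
    conj (beamSplitterU τ out inp) = beamSplitterU τ out inp := by
  rw [beamSplitterU_apply, map_mul, Complex.conj_ofReal, ← MvPolynomial.coeff_map, map_conj_bsPoly]

/-- Conservation of the total photon number, from homogeneity of the polynomial. -/
theorem beamSplitterU_eq_zero (τ : ℝ) {out inp : Occ D × Occ D}
    (h : occDegree out ≠ occDegree inp) : beamSplitterU τ out inp = 0 := by
  rw [beamSplitterU_apply, (isHomogeneous_bsPoly τ inp).coeff_eq_zero, mul_zero]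
  rwa [degree_occExponent]

theorem occFactorial_pos (n : Occ D) : 0 < occFactorial n :=
  Finset.prod_pos fun _ _ => Nat.factorial_pos _

theorem sum_coeff_mul_prod {σ : Type} [Fintype σ] (P : MvPolynomial σ ℂ) (z : σ → ℂ) :
    HasSum (fun d => MvPolynomial.coeff d P * ∏ i, z i ^ d i) (MvPolynomial.eval z P) := by
  rw [MvPolynomial.eval_eq']
  refine hasSum_sum_of_ne_finset_zero fun d hd => ?_
  rw [MvPolynomial.notMem_support_iff.1 hd, zero_mul]

/-- The adjoint of the beam splitter maps coherent states to coherent states. -/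
theorem hasSum_beamSplitterU_coherent {τ : ℝ} (hτ0 : 0 ≤ τ) (hτ1 : τ ≤ 1)
    (z : (Fin D → ℂ) × (Fin D → ℂ)) (a : Occ D × Occ D) :
    HasSum (fun o : Occ D × Occ D =>
      conj (beamSplitterU τ o a) * (coherent z.1 o.1 * coherent z.2 o.2))
      (coherent (bsRotation D √τ √(1 - τ) z).1 a.1 * coherent (bsRotation D √τ √(1 - τ) z).2 a.2) := by
  set w := bsRotation D √τ √(1 - τ) z with hw
  have hst : √τ ^ 2 + √(1 - τ) ^ 2 = 1 := by
    rw [Real.sq_sqrt hτ0, Real.sq_sqrt (by linarith)]; ring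
  have hnorm : ∑ j, ‖w.1 j‖ ^ 2 + ∑ j, ‖w.2 j‖ ^ 2 = ∑ j, ‖z.1 j‖ ^ 2 + ∑ j, ‖z.2 j‖ ^ 2 := by
    rw [← Finset.sum_add_distrib, ← Finset.sum_add_distrib]
    refine Finset.sum_congr rfl fun j _ => ?_
    simp only [hw, bsRotation_apply, Pi.sub_apply, Pi.add_apply, Pi.smul_apply,
      ← Complex.normSq_eq_norm_sq, Complex.normSq_apply, Complex.sub_re, Complex.add_re,
      Complex.sub_im, Complex.add_im, Complex.smul_re, Complex.smul_im, smul_eq_mul]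
    linear_combination ((z.1 j).re ^ 2 + (z.1 j).im ^ 2 + (z.2 j).re ^ 2 + (z.2 j).im ^ 2) * hst
  have hcoh : ∀ (u : (Fin D → ℂ) × (Fin D → ℂ)) (n : Occ D × Occ D),
      coherent u.1 n.1 * coherent u.2 n.2 =
      ((Real.exp (-(∑ j, ‖u.1 j‖ ^ 2 + ∑ j, ‖u.2 j‖ ^ 2) / 2) : ℝ) : ℂ) *
      ((∏ i, Sum.elim u.1 u.2 i ^ occExponent n i) /
        ((√((occFactorial n.1 * occFactorial n.2 : ℕ) : ℝ) : ℝ) : ℂ)) := by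
    intro u n
    have h1 : Real.exp (-(∑ j, ‖u.1 j‖ ^ 2 + ∑ j, ‖u.2 j‖ ^ 2) / 2) =
        Real.exp (-(∑ j, ‖u.1 j‖ ^ 2) / 2) * Real.exp (-(∑ j, ‖u.2 j‖ ^ 2) / 2) := by
      rw [← Real.exp_add]; congr 1; ring
    rw [h1, coherent, coherent, Fintype.prod_sum_type, Nat.cast_mul,
      Real.sqrt_mul (by positivity)]
    simp only [Sum.elim_inl, Sum.elim_inr, occExponent_inl, occExponent_inr]
    push_cast
    rw [mul_mul_mul_comm, div_mul_div_comm]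
  -- The linear forms defining `bsPoly`, evaluated at `z`, are the coordinates of the rotated point
  -- `w`; the expansion of the polynomial is therefore the coherent amplitude at `w`. The Gaussian
  -- prefactors agree by `hnorm`.
  have heval : MvPolynomial.eval (Sum.elim z.1 z.2) (bsPoly τ a) =
      ∏ i, Sum.elim w.1 w.2 i ^ occExponent a i := by
    rw [Fintype.prod_sum_type, ← Finset.prod_mul_distrib, bsPoly, map_prod]
    refine Finset.prod_congr rfl fun j _ => ?_
    simp [hw, bsRotation_apply, occExponent_inl, occExponent_inr]
  have h := (occExponent (D := D)).hasSum_iff.2 (sum_coeff_mul_prod (bsPoly τ a) (Sum.elim z.1 z.2))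
  rw [heval] at h
  have h2 := h.mul_left
    (((Real.exp (-(∑ j, ‖z.1 j‖ ^ 2 + ∑ j, ‖z.2 j‖ ^ 2) / 2) : ℝ) : ℂ) /
      ((√((occFactorial a.1 * occFactorial a.2 : ℕ) : ℝ) : ℝ) : ℂ))
  rw [hcoh, hnorm]
  convert! h2 using 1
  · ext o
    rw [conj_beamSplitterU, beamSplitterU_apply, hcoh, Real.sqrt_div (by positivity)]
    have ho : ((√((occFactorial o.1 * occFactorial o.2 : ℕ) : ℝ) : ℝ) : ℂ) ≠ 0 := by
      rw [Complex.ofReal_ne_zero]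
      have := occFactorial_pos o.1
      have := occFactorial_pos o.2
      positivity
    simp only [Function.comp_apply, Complex.ofReal_div]
    field_simp
  · rw [div_mul_eq_mul_div, mul_div_assoc]

end Bosonic

namespace Bosonic

variable {D : ℕ}

/-- The normalized coherent amplitudes of two systems. -/
noncomputable def coherentFun₂ (n : Occ D × Occ D) (z : (Fin D → ℂ) × (Fin D → ℂ)) : ℂ :=
  coherentFun n.1 z.1 * coherentFun n.2 z.2

theorem isL2Orthonormal_coherentFun₂ :
    IsL2Orthonormal (volume : Measure ((Fin D → ℂ) × (Fin D → ℂ))) (coherentFun₂ (D := D)) :=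
  isL2Orthonormal_coherentFun.prod isL2Orthonormal_coherentFun

theorem summable_sq_norm_coherentFun₂ (z : (Fin D → ℂ) × (Fin D → ℂ)) :
    Summable fun n => ‖coherentFun₂ n z‖ ^ 2 := by
  simp_rw [coherentFun₂, norm_mul, mul_pow]
  exact (summable_sq_norm_coherentFun z.1).mul_of_nonneg (summable_sq_norm_coherentFun z.2)
    (fun _ => sq_nonneg _) (fun _ => sq_nonneg _)

/-- The states with at most `N` photons. -/
noncomputable def occBall (D N : ℕ) : Finset (Occ D × Occ D) :=
  ((Fintype.piFinset fun _ => Finset.range (N + 1)) ×ˢ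
    (Fintype.piFinset fun _ => Finset.range (N + 1))).filter fun n => occDegree n ≤ N

theorem mem_occBall {N : ℕ} {n : Occ D × Occ D} : n ∈ occBall D N ↔ occDegree n ≤ N := by
  rw [occBall, Finset.mem_filter, Finset.mem_product, Fintype.mem_piFinset, Fintype.mem_piFinset]
  refine ⟨fun h => h.2, fun h => ⟨⟨fun j => ?_, fun j => ?_⟩, h⟩⟩
  · have := Finset.single_le_sum (f := n.1) (fun _ _ => Nat.zero_le _) (Finset.mem_univ j)
    rw [Finset.mem_range]
    unfold occDegree at h
    omega
  · have := Finset.single_le_sum (f := n.2) (fun _ _ => Nat.zero_le _) (Finset.mem_univ j)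
    rw [Finset.mem_range]
    unfold occDegree at h
    omega

theorem hasSum_beamSplitterU_coherentFun₂ {τ : ℝ} (hτ0 : 0 ≤ τ) (hτ1 : τ ≤ 1)
    (z : (Fin D → ℂ) × (Fin D → ℂ)) (a : Occ D × Occ D) :
    HasSum (fun o => conj (beamSplitterU τ o a) * coherentFun₂ o z)
      (coherentFun₂ a (bsRotation D √τ √(1 - τ) z)) := by
  have h := (hasSum_beamSplitterU_coherent hτ0 hτ1 z a).div_const
    (((√(Real.pi ^ D) : ℝ) : ℂ) * ((√(Real.pi ^ D) : ℝ) : ℂ))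
  convert! h using 1
  · ext o
    rw [coherentFun₂, coherentFun, coherentFun]
    ring
  · rw [coherentFun₂, coherentFun, coherentFun]
    ring

theorem sq_sqrt_add_sq_sqrt {τ : ℝ} (hτ0 : 0 ≤ τ) (hτ1 : τ ≤ 1) : √τ ^ 2 + √(1 - τ) ^ 2 = 1 := by
  rw [Real.sq_sqrt hτ0, Real.sq_sqrt (by linarith)]; ring

/-- Unitarity is read off in function space. The entries of `U` are the coefficients of the rotated
amplitudes in the orthonormal family `coherentFun₂`, and a measure-preserving rotation keeps inner
products. The photon-number balls serve as blocks. -/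
theorem isGradedUnitary_beamSplitterU {τ : ℝ} (hτ0 : 0 ≤ τ) (hτ1 : τ ≤ 1) :
    IsGradedUnitary (beamSplitterU (D := D) τ) (occBall D) := by
  have hdeg : ∀ o a : Occ D × Occ D, beamSplitterU τ o a ≠ 0 → occDegree o = occDegree a :=
    fun o a h => by_contra fun h' => h (beamSplitterU_eq_zero τ h')
  have he := isL2Orthonormal_coherentFun₂ (D := D)
  have hfin : ∀ N, ∀ a ∈ occBall D N, ∀ z : (Fin D → ℂ) × (Fin D → ℂ),
      coherentFun₂ a (bsRotation D √τ √(1 - τ) z) =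
        ∑ o ∈ occBall D N, conj (beamSplitterU τ o a) * coherentFun₂ o z := by
    intro N a ha z
    rw [← (hasSum_beamSplitterU_coherentFun₂ hτ0 hτ1 z a).tsum_eq]
    refine tsum_eq_sum fun o ho => ?_
    have : beamSplitterU τ o a = 0 := by
      by_contra h0
      rw [mem_occBall] at ho ha
      exact ho ((hdeg o a h0).trans_le ha)
    rw [this, map_zero, zero_mul]
  have hint : ∀ m n : Occ D × Occ D, Integrable fun z : (Fin D → ℂ) × (Fin D → ℂ) =>
      conj (coherentFun₂ m z) * coherentFun₂ n z := by
    intro m n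
    have := (he.memLp m).star.integrable_mul (he.memLp n)
    exact this
  have key : ∀ N, ∀ a ∈ occBall D N, ∀ b ∈ occBall D N,
      ∑ o ∈ occBall D N, beamSplitterU τ o a * conj (beamSplitterU τ o b) =
        ∫ z : (Fin D → ℂ) × (Fin D → ℂ), conj (coherentFun₂ a z) * coherentFun₂ b z := by
    intro N a ha b hb
    rw [← integral_comp_bsRotation _ _ (sq_sqrt_add_sq_sqrt hτ0 hτ1)]
    have h1 : ∀ z : (Fin D → ℂ) × (Fin D → ℂ),
        conj (coherentFun₂ a (bsRotation D √τ √(1 - τ) z)) *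
          coherentFun₂ b (bsRotation D √τ √(1 - τ) z) =
        ∑ o ∈ occBall D N, ∑ o' ∈ occBall D N, beamSplitterU τ o a * conj (beamSplitterU τ o' b) *
          (conj (coherentFun₂ o z) * coherentFun₂ o' z) := by
      intro z
      rw [hfin N a ha, hfin N b hb, map_sum, Finset.sum_mul_sum]
      refine Finset.sum_congr rfl fun o _ => Finset.sum_congr rfl fun o' _ => ?_
      rw [map_mul, RCLike.conj_conj]
      ring
    simp_rw [h1]
    rw [integral_finsetSum _ fun o _ => integrable_finsetSum _ fun o' _ => (hint o o').const_mul _]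
    refine Finset.sum_congr rfl fun o ho => ?_
    rw [integral_finsetSum _ fun o' _ => (hint o o').const_mul _]
    simp_rw [integral_const_mul]
    rw [Finset.sum_eq_single o]
    · rw [he.integral_eq_one, mul_one]
    · intro o' _ hne
      rw [he.integral_eq_zero _ _ hne.symm, mul_zero]
    · exact fun h => absurd ho h
  refine ⟨fun N M hNM n hn => ?_, fun n => ⟨occDegree n, mem_occBall.2 le_rfl⟩, fun o a h N => ?_,
    fun N a ha => ?_, fun N a ha b hb hab => ?_⟩
  · rw [mem_occBall] at hn ⊢
    exact hn.trans hNM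
  · rw [mem_occBall, mem_occBall, hdeg o a h]
  · rw [key N a ha a ha, he.integral_eq_one]
  · rw [key N a ha b hb, he.integral_eq_zero _ _ hab]

/-- The joint output state of the beam splitter. -/
noncomputable def bsOutput (τ : ℝ) (ρX ρY : Matrix (Occ D) (Occ D) ℂ) :
    Matrix (Occ D × Occ D) (Occ D × Occ D) ℂ :=
  opMul (opMul (beamSplitterU τ) (ρX ⊗ₖ ρY)) (beamSplitterU τ)ᴴ

theorem quantumConv_eq (τ : ℝ) (ρX ρY : Matrix (Occ D) (Occ D) ℂ) :
    quantumConv τ ρX ρY = partialTrace (bsOutput τ ρX ρY) := rfl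

theorem IsDensity.hasSum_kronecker {ρX ρY : Matrix (Occ D) (Occ D) ℂ} (hX : IsDensity ρX)
    (hY : IsDensity ρY) : HasSum (fun i => (ρX ⊗ₖ ρY) i i) ((1 : ℝ) : ℂ) := by
  have hs : Summable fun i : Occ D × Occ D => ρX i.1 i.1 * ρY i.2 i.2 :=
    summable_mul_of_summable_norm (f := fun i => ρX i i) (g := fun i => ρY i i)
      hX.2.summable.norm hY.2.summable.norm
  have h : HasSum (fun i : Occ D × Occ D => ρX i.1 i.1 * ρY i.2 i.2) (1 * 1) :=
    HasSum.mul (f := fun i => ρX i i) (g := fun i => ρY i i) hX.2 hY.2 hs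
  rw [Complex.ofReal_one, ← one_mul (1 : ℂ)]
  exact h

/-- The joint output Husimi function is the product of the input ones, composed with the rotation,
since `U†` sends coherent states to coherent states. -/
theorem bsOutput_spec {ρX ρY : Matrix (Occ D) (Occ D) ℂ} (hX : IsDensity ρX)
    (hY : IsDensity ρY) {τ : ℝ} (hτ0 : 0 ≤ τ) (hτ1 : τ ≤ 1) :
    (bsOutput τ ρX ρY).PosSemidef ∧ HasSum (fun i => bsOutput τ ρX ρY i i) 1 ∧
    ∀ z, quadForm (bsOutput τ ρX ρY) (fun n => coherentFun₂ n z) =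
      (husimi ρX (bsRotation D √τ √(1 - τ) z).1 : ℂ) * husimi ρY (bsRotation D √τ √(1 - τ) z).2 := by
  obtain ⟨h1, h2, h3⟩ := (isGradedUnitary_beamSplitterU (D := D) hτ0 hτ1).conj_density
    (hX.1.kronecker_infinite hY.1) (hX.hasSum_kronecker hY)
  rw [Complex.ofReal_one] at h2
  refine ⟨h1, h2, fun z => ?_⟩
  refine (h3 _ _ (summable_sq_norm_coherentFun₂ z)
    (summable_sq_norm_coherentFun₂ (bsRotation D √τ √(1 - τ) z))
    fun a => ((hasSum_beamSplitterU_coherentFun₂ hτ0 hτ1 z a).tsum_eq).symm).trans ?_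
  exact (hX.1.quadForm_kronecker hY.1 hX.summable_diag hY.summable_diag
    (summable_sq_norm_coherentFun _) (summable_sq_norm_coherentFun _)).trans
    (by rw [hX.quadForm_eq_husimi, hY.quadForm_eq_husimi])

end Bosonic

/-! ### Partial traces -/

section PartialTrace

open Bosonic

variable {ι κ : Type}

/-- The Gram vectors are the sequences `k ↦ v (m, k)` in `ℓ²(κ; H)`. -/
theorem Matrix.PosSemidef.partialTrace {M : Matrix (ι × κ) (ι × κ) ℂ} (hM : M.PosSemidef)
    (hs : Summable fun i => M i i) : (partialTrace M).PosSemidef := by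
  obtain ⟨H, i1, i2, i3, v, hv, hs'⟩ := hM.exists_gram_summable hs
  have hmem : ∀ m, Memℓp (fun k => v (m, k)) 2 := by
    intro m
    rw [memℓp_gen_iff (by norm_num)]
    simpa using hs'.prod_factor m
  refine Matrix.PosSemidef.of_gram (v := fun m => (⟨fun k => v (m, k), hmem m⟩ : lp (fun _ : κ => H) 2))
    fun m m' => ?_
  rw [lp.inner_eq_tsum]
  exact tsum_congr fun k => hv _ _

theorem hasSum_partialTrace {M : Matrix (ι × κ) (ι × κ) ℂ} {t : ℂ}
    (hs : HasSum (fun i => M i i) t) : HasSum (fun m => partialTrace M m m) t :=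
  hs.prod_fiberwise fun m => (hs.summable.prod_factor m).hasSum

/-- The duality `Tr((Tr₂ M) T) = Tr(M (T ⊗ 1))`. -/
theorem tsum_partialTrace_mul {M : Matrix (ι × κ) (ι × κ) ℂ} (hM : M.PosSemidef)
    (hs : Summable fun i => M i i) {T : Matrix ι ι ℂ} (hT : ∀ m, Summable fun m' => ‖T m' m‖ ^ 2)
    {t : ℂ} (ht : HasSum (fun n : ι × κ => ∑' m', M n (m', n.2) * T m' n.1) t) :
    ∑' m, ∑' m', partialTrace M m m' * T m' m = t := by
  obtain ⟨H, i1, i2, i3, v, hv, hs'⟩ := hM.exists_gram_summable hs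
  have h1 := ht.prod_fiberwise fun m => (ht.summable.prod_factor m).hasSum
  rw [← h1.tsum_eq]
  refine tsum_congr fun m => ?_
  -- For fixed `m` the terms are dominated by `‖T m' m‖² ‖v (m, k)‖² + ‖v (m', k)‖²`, which permits
  -- exchanging the sums over `m'` and `k`.
  have h2 : Summable (Function.uncurry fun (m' : ι) (k : κ) => M (m, k) (m', k) * T m' m) := by
    have h3 := ((hT m).mul_of_nonneg (hs'.prod_factor m) (fun _ => sq_nonneg _)
      (fun _ => sq_nonneg _)).add hs'
    refine Summable.of_norm (h3.of_nonneg_of_le (fun _ => norm_nonneg _) fun n => ?_)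
    simp only [Function.uncurry]
    rw [norm_mul, hv]
    have h4 := norm_inner_le_norm (𝕜 := ℂ) (v (m, n.2)) (v (n.1, n.2))
    have h5 := mul_le_mul_of_nonneg_right h4 (norm_nonneg (T n.1 m))
    rw [← mul_pow]
    change _ ≤ _ + ‖v (n.1, n.2)‖ ^ 2
    nlinarith [sq_nonneg (‖T n.1 m‖ * ‖v (m, n.2)‖ - ‖v (n.1, n.2)‖),
      sq_nonneg (‖T n.1 m‖ * ‖v (m, n.2)‖), sq_nonneg (‖v (n.1, n.2)‖)]
  rw [h2.tsum_comm]
  refine tsum_congr fun m' => ?_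
  rw [partialTrace, tsum_mul_right]

end PartialTrace

/-! ### The characteristic function of the quantum convolution -/

namespace Bosonic

variable {D : ℕ}

/-- Bessel's inequality for the orthonormal family `h e k`. -/
theorem summable_sq_norm_integral {ι X : Type} [MeasurableSpace X] {μ : Measure X}
    {e : ι → X → ℂ} (he : IsL2Orthonormal μ e) {h : X → ℂ} (hm : Measurable h)
    (hh : ∀ x, ‖h x‖ = 1) (i : ι) :
    Summable fun k => ‖∫ x, conj (e i x) * e k x * h x ∂μ‖ ^ 2 := by
  have he' := he.mul_unimodular hm hh
  have ho : Orthonormal ℂ fun k => he'.tensor k (1 : ℂ) := by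
    refine ⟨fun k => by simp, fun k l hkl => he'.orthogonalFamily hkl 1 1⟩
  refine (ho.inner_products_summable (he.tensor i (1 : ℂ))).congr fun k => ?_
  have := inner_toLp_smul_toLp_smul (he.memLp i) (he'.memLp k) (1 : ℂ) 1
  rw [norm_inner_symm]
  congr 2
  refine this.trans ?_
  simp only [inner_self_eq_norm_sq_to_K]
  simp only [norm_one, RCLike.ofReal_one, one_pow, mul_one]
  congr 1
  ext x
  ring

theorem phaseChar_smul_add (ξ : Fin D → ℂ) (s t : ℝ) (α β : Fin D → ℂ) :
    phaseChar ξ (s • α + t • β) = phaseChar (s • ξ) α * phaseChar (t • ξ) β := by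
  rw [phaseChar, phaseChar, phaseChar, ← Complex.exp_add, ← Finset.sum_add_distrib]
  congr 1
  refine Finset.sum_congr rfl fun j _ => ?_
  simp
  ring

theorem sum_norm_smul_sq (s : ℝ) (ξ : Fin D → ℂ) :
    ∑ j, ‖(s • ξ) j‖ ^ 2 = s ^ 2 * ∑ j, ‖ξ j‖ ^ 2 := by
  rw [Finset.mul_sum]
  refine Finset.sum_congr rfl fun j _ => ?_
  rw [Pi.smul_apply, norm_smul, mul_pow, Real.norm_eq_abs, sq_abs]

variable {ρX ρY : Matrix (Occ D) (Occ D) ℂ} {τ : ℝ}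

theorem IsDensity.quantumConv (hX : IsDensity ρX) (hY : IsDensity ρY) (hτ0 : 0 ≤ τ) (hτ1 : τ ≤ 1) :
    IsDensity (quantumConv τ ρX ρY) := by
  obtain ⟨h1, h2, -⟩ := bsOutput_spec hX hY hτ0 hτ1
  exact ⟨h1.partialTrace h2.summable, hasSum_partialTrace h2⟩

/-- A character of the first output variable is integrated against the joint Husimi function.
Undoing the rotation factors the integral over the two inputs, and the damping `exp(-|ξ|²/2)` splits
as `τ + (1-τ) = 1`, so it cancels. -/
theorem charFn_quantumConv (hX : IsDensity ρX) (hY : IsDensity ρY) (hτ0 : 0 ≤ τ) (hτ1 : τ ≤ 1)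
    (ξ : Fin D → ℂ) :
    charFn (quantumConv τ ρX ρY) ξ = charFn ρX (√τ • ξ) * charFn ρY (√(1 - τ) • ξ) := by
  obtain ⟨h1, h2, h3⟩ := bsOutput_spec hX hY hτ0 hτ1
  have hst := sq_sqrt_add_sq_sqrt hτ0 hτ1
  set E : ℂ := ((Real.exp (-(∑ j, ‖ξ j‖ ^ 2) / 2) : ℝ) : ℂ) with hE
  have hE0 : E ≠ 0 := by
    rw [hE, Complex.ofReal_ne_zero]
    exact (Real.exp_pos _).ne'
  have hm := (continuous_phaseChar ξ).measurable
  have h4 := (isL2Orthonormal_coherentFun₂.trace_formula summable_sq_norm_coherentFun₂ h1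
    h2.summable (hm.comp measurable_fst) (fun z => norm_phaseChar ξ z.1)).2.2
  have h5 : ∀ i k : Occ D × Occ D, ∫ z : (Fin D → ℂ) × (Fin D → ℂ),
      conj (coherentFun₂ i z) * coherentFun₂ k z * (phaseChar ξ ∘ Prod.fst) z =
      (∫ α, conj (coherentFun i.1 α) * coherentFun k.1 α * phaseChar ξ α) *
        ∫ β, conj (coherentFun i.2 β) * coherentFun k.2 β := by
    intro i k
    rw [Measure.volume_eq_prod, ← integral_prod_mul
      (fun α => conj (coherentFun i.1 α) * coherentFun k.1 α * phaseChar ξ α)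
      (fun β => conj (coherentFun i.2 β) * coherentFun k.2 β)]
    refine integral_congr_ae (ae_of_all _ fun z => ?_)
    simp only [coherentFun₂, map_mul, Function.comp_apply]
    ring
  -- The character ignores the second mode, so orthonormality there forces `k.2 = i.2` and the
  -- partial trace appears.
  have h6 : ∀ i : Occ D × Occ D, ∑' k, bsOutput τ ρX ρY i k * ∫ z : (Fin D → ℂ) × (Fin D → ℂ),
      conj (coherentFun₂ i z) * coherentFun₂ k z * (phaseChar ξ ∘ Prod.fst) z =
      ∑' m', bsOutput τ ρX ρY i (m', i.2) *
        ∫ α, conj (coherentFun i.1 α) * coherentFun m' α * phaseChar ξ α := by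
    intro i
    have hinj : Function.Injective fun m' : Occ D => (m', i.2) :=
      fun a b hab => congrArg Prod.fst hab
    rw [← hinj.tsum_eq]
    · refine tsum_congr fun m' => ?_
      rw [h5, isL2Orthonormal_coherentFun.integral_eq_one, mul_one]
    · intro k hk
      by_cases hki : k.2 = i.2
      · exact ⟨k.1, Prod.ext rfl hki.symm⟩
      · refine absurd ?_ hk
        beta_reduce
        rw [h5, isL2Orthonormal_coherentFun.integral_eq_zero _ _ (Ne.symm hki), mul_zero, mul_zero]
  simp_rw [h6] at h4
  have h7 := tsum_partialTrace_mul
    (T := fun m' m => ∫ α, conj (coherentFun m α) * coherentFun m' α * phaseChar ξ α) h1 h2.summable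
    (fun m => summable_sq_norm_integral isL2Orthonormal_coherentFun hm
      (norm_phaseChar ξ) m) h4
  have h8 : E * charFn (quantumConv τ ρX ρY) ξ = ∫ z : (Fin D → ℂ) × (Fin D → ℂ),
      quadForm (bsOutput τ ρX ρY) (fun i => coherentFun₂ i z) * (phaseChar ξ ∘ Prod.fst) z := by
    rw [← h7, charFn, opTrace, ← tsum_mul_left]
    refine tsum_congr fun i => ?_
    rw [opMul, ← tsum_mul_left]
    refine tsum_congr fun k => ?_
    rw [integral_coherentFun_phaseChar, quantumConv_eq]
    ring
  have h9 : ∫ z : (Fin D → ℂ) × (Fin D → ℂ),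
      quadForm (bsOutput τ ρX ρY) (fun i => coherentFun₂ i z) * (phaseChar ξ ∘ Prod.fst) z =
      (∫ α, (husimi ρX α : ℂ) * phaseChar (√τ • ξ) α) *
        ∫ β, (husimi ρY β : ℂ) * phaseChar (√(1 - τ) • ξ) β := by
    -- Substituting the inverse rotation turns the first variable into `√τ α + √(1-τ) β` and the
    -- Husimi product into `Q_X(α) Q_Y(β)`.
    rw [← integral_comp_bsRotation √τ (-√(1 - τ)) (by rw [neg_sq]; exact hst)]
    rw [Measure.volume_eq_prod, ← integral_prod_mul]
    refine integral_congr_ae (ae_of_all _ fun z => ?_)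
    simp only [h3, bsRotation_bsRotation_neg _ _ hst, Function.comp_apply]
    rw [bsRotation_apply]
    simp only [neg_smul, sub_neg_eq_add]
    rw [phaseChar_smul_add]
    ring
  rw [h9, hX.integral_husimi_phaseChar, hY.integral_husimi_phaseChar] at h8
  have h10 : ((Real.exp (-(∑ j, ‖(√τ • ξ) j‖ ^ 2) / 2) : ℝ) : ℂ) *
      ((Real.exp (-(∑ j, ‖(√(1 - τ) • ξ) j‖ ^ 2) / 2) : ℝ) : ℂ) = E := by
    rw [sum_norm_smul_sq, sum_norm_smul_sq, hE, ← Complex.ofReal_mul, ← Real.exp_add]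
    congr 2
    linear_combination (-(∑ j, ‖ξ j‖ ^ 2) / 2) * hst
  refine mul_left_cancel₀ hE0 ?_
  rw [h8, ← h10]
  ring

end Bosonic

/-! ### Fourier analysis on phase space and linear changes of variables -/

namespace Bosonic

variable {D : ℕ}

/-- The symplectic pairing `2 Im(ξ · ᾱ)`, as a functional of `α`. -/
noncomputable def symplectic (ξ : Fin D → ℂ) : StrongDual ℝ (Fin D → ℂ) :=
  LinearMap.toContinuousLinearMap
    { toFun := fun α => ∑ j, 2 * ((ξ j).im * (α j).re - (ξ j).re * (α j).im)
      map_add' := fun α β => by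
        rw [← Finset.sum_add_distrib]
        refine Finset.sum_congr rfl fun j _ => ?_
        simp
        ring
      map_smul' := fun c α => by
        rw [RingHom.id_apply, smul_eq_mul, Finset.mul_sum]
        refine Finset.sum_congr rfl fun j _ => ?_
        simp
        ring }

theorem symplectic_apply (ξ α : Fin D → ℂ) :
    symplectic ξ α = ∑ j, 2 * ((ξ j).im * (α j).re - (ξ j).re * (α j).im) := rfl

theorem phaseChar_eq_symplectic (ξ α : Fin D → ℂ) :
    phaseChar ξ α = Complex.exp ((symplectic ξ α : ℝ) * Complex.I) := by
  rw [phaseChar, symplectic_apply, Complex.ofReal_sum, Finset.sum_mul]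
  congr 1
  refine Finset.sum_congr rfl fun j _ => ?_
  apply Complex.ext
  · simp [mul_comm]
  · simp
    ring

theorem exists_symplectic_eq (L : StrongDual ℝ (Fin D → ℂ)) : ∃ ξ, symplectic ξ = L := by
  refine ⟨fun j => ⟨-L (Pi.single j Complex.I) / 2, L (Pi.single j 1) / 2⟩,
    ContinuousLinearMap.ext fun α => ?_⟩
  have h : α = ∑ j, ((α j).re • (Pi.single j (1 : ℂ) : Fin D → ℂ) +
      (α j).im • (Pi.single j Complex.I : Fin D → ℂ)) := by
    conv_lhs => rw [← Finset.univ_sum_single α]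
    refine Finset.sum_congr rfl fun j _ => ?_
    rw [← Pi.single_smul, ← Pi.single_smul, ← Pi.single_add]
    congr 1
    apply Complex.ext <;> simp
  conv_rhs => rw [h]
  rw [map_sum, symplectic_apply]
  refine Finset.sum_congr rfl fun j _ => ?_
  rw [map_add, map_smul, map_smul, smul_eq_mul, smul_eq_mul]
  ring

theorem symplectic_ne_zero {ξ : Fin D → ℂ} (h : ξ ≠ 0) : symplectic ξ ≠ 0 := by
  intro h0
  obtain ⟨j, hj⟩ := Function.ne_iff.1 h
  have h1 := congrArg (fun L => L (Pi.single j (1 : ℂ))) h0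
  have h2 := congrArg (fun L => L (Pi.single j Complex.I)) h0
  simp only [symplectic_apply] at h1 h2
  rw [Finset.sum_eq_single j (fun k _ hk => by simp [hk]) (by simp)] at h1 h2
  apply hj
  apply Complex.ext
  · simpa using h2
  · simpa using h1

/-- Every real functional is a symplectic pairing, so the hypothesis equates the full characteristic
functions of the finite measures with densities `f` and `g`. -/
theorem ae_eq_of_integral_phaseChar_eq {f g : (Fin D → ℂ) → ℝ} (hf : Integrable f)
    (hg : Integrable g) (hf0 : ∀ α, 0 ≤ f α) (hg0 : ∀ α, 0 ≤ g α)
    (h : ∀ ξ, ∫ α, (f α : ℂ) * phaseChar ξ α = ∫ α, (g α : ℂ) * phaseChar ξ α) :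
    f =ᵐ[volume] g := by
  have key : ∀ {f : (Fin D → ℂ) → ℝ}, Integrable f → (∀ α, 0 ≤ f α) → ∀ ξ,
      charFunDual (volume.withDensity fun α => ENNReal.ofReal (f α)) (symplectic ξ) =
        ∫ α, (f α : ℂ) * phaseChar ξ α := by
    intro f hf hf0 ξ
    rw [charFunDual_apply, integral_withDensity_eq_integral_toReal_smul₀
      hf.aestronglyMeasurable.aemeasurable.ennreal_ofReal (ae_of_all _ fun _ => ENNReal.ofReal_lt_top)]
    refine integral_congr_ae (ae_of_all _ fun α => ?_)
    simp only [ENNReal.toReal_ofReal (hf0 α), phaseChar_eq_symplectic, Complex.real_smul]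
  have hfin : ∀ {f : (Fin D → ℂ) → ℝ}, Integrable f → ∫⁻ α, ENNReal.ofReal (f α) ≠ ⊤ :=
    fun hf => hf.lintegral_lt_top.ne
  have := isFiniteMeasure_withDensity (hfin hf)
  have := isFiniteMeasure_withDensity (hfin hg)
  have h1 : (volume.withDensity fun α => ENNReal.ofReal (f α)) =
      volume.withDensity fun α => ENNReal.ofReal (g α) := by
    refine Measure.ext_of_charFunDual (funext fun L => ?_)
    obtain ⟨ξ, rfl⟩ := exists_symplectic_eq L
    rw [key hf hf0, key hg hg0, h]
  rw [withDensity_eq_iff hf.aestronglyMeasurable.aemeasurable.ennreal_ofReal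
    hg.aestronglyMeasurable.aemeasurable.ennreal_ofReal (hfin hf)] at h1
  filter_upwards [h1] with α hα
  have := congrArg ENNReal.toReal hα
  rwa [ENNReal.toReal_ofReal (hf0 α), ENNReal.toReal_ofReal (hg0 α)] at this

/-- The Riemann–Lebesgue lemma along a ray. -/
theorem tendsto_integral_phaseChar_smul (f : (Fin D → ℂ) → ℝ) {ξ : Fin D → ℂ} (hξ : ξ ≠ 0) :
    Filter.Tendsto (fun t : ℝ => ∫ α, (f α : ℂ) * phaseChar (t • ξ) α) Filter.atTop (nhds 0) := by
  have hvol : (volume : Measure (Fin D → ℂ)).IsAddHaarMeasure := Measure.pi.isAddHaarMeasure _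
  have h := tendsto_integral_exp_smul_cocompact (fun α => (f α : ℂ))
    (volume : Measure (Fin D → ℂ))
  have hn : 0 < ‖symplectic ξ‖ := norm_pos_iff.2 (symplectic_ne_zero hξ)
  -- The factor `-1/(2π)` converts from the convention `exp(-2πi w(v))`.
  have h2 : Filter.Tendsto (fun t : ℝ => (-(t / (2 * Real.pi))) • symplectic ξ) Filter.atTop
      (Filter.cocompact (StrongDual ℝ (Fin D → ℂ))) := by
    rw [← Metric.cobounded_eq_cocompact, ← tendsto_norm_atTop_iff_cobounded]
    have h3 : Filter.Tendsto (fun t : ℝ => t * (‖symplectic ξ‖ / (2 * Real.pi)))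
        Filter.atTop Filter.atTop :=
      Filter.tendsto_id.atTop_mul_const (by positivity)
    refine h3.congr' ?_
    filter_upwards [Filter.eventually_ge_atTop 0] with t ht
    rw [norm_smul, norm_neg, Real.norm_eq_abs, abs_of_nonneg (by positivity)]
    ring
  refine (h.comp h2).congr fun t => ?_
  simp only [Function.comp_apply]
  refine integral_congr_ae (ae_of_all _ fun α => ?_)
  simp only [Circle.smul_def, Real.fourierChar_apply, smul_eq_mul]
  rw [mul_comm, phaseChar_eq_symplectic]
  congr 2
  have h4 : symplectic (t • ξ) α = t * symplectic ξ α := by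
    rw [symplectic_apply, symplectic_apply, Finset.mul_sum]
    refine Finset.sum_congr rfl fun j _ => ?_
    simp
    ring
  rw [h4]
  congr 1
  have h5 : ((-(t / (2 * Real.pi))) • symplectic ξ) α = -(t / (2 * Real.pi)) * symplectic ξ α := rfl
  rw [h5]
  congr 1
  have := Real.pi_ne_zero
  field_simp

/-- The phase-space coordinates, as a linear equivalence. -/
def realCoordEquiv (D : ℕ) : (Fin D → ℂ) ≃ₗ[ℝ] (Fin D ⊕ Fin D → ℝ) where
  toFun := realCoord
  map_add' α β := by
    ext (j | j) <;> simp [realCoord]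
  map_smul' c α := by
    ext (j | j) <;> simp [realCoord]
  invFun x j := ⟨x (Sum.inl j), x (Sum.inr j)⟩
  left_inv α := by
    ext j; simp [realCoord]
  right_inv x := by
    ext (j | j) <;> simp [realCoord]

theorem realCoordEquiv_apply (α : Fin D → ℂ) : realCoordEquiv D α = realCoord α := rfl

theorem realCoord_symm (x : Fin D ⊕ Fin D → ℝ) : realCoord ((realCoordEquiv D).symm x) = x :=
  (realCoordEquiv D).apply_symm_apply x

theorem realCoord_dotProduct_self (ξ : Fin D → ℂ) :
    realCoord ξ ⬝ᵥ realCoord ξ = ∑ j, ‖ξ j‖ ^ 2 := by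
  rw [dotProduct, Fintype.sum_sum_type, ← Finset.sum_add_distrib]
  refine Finset.sum_congr rfl fun j _ => ?_
  rw [← Complex.normSq_eq_norm_sq, Complex.normSq_apply]
  rfl

/-- The matrix of the symplectic pairing. -/
def symplecticMatrix (D : ℕ) : Matrix (Fin D ⊕ Fin D) (Fin D ⊕ Fin D) ℝ :=
  Matrix.fromBlocks 0 ((-2 : ℝ) • 1) ((2 : ℝ) • 1) 0

theorem symplectic_eq_dotProduct (ξ α : Fin D → ℂ) :
    symplectic ξ α = realCoord ξ ⬝ᵥ (symplecticMatrix D *ᵥ realCoord α) := by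
  have h : symplecticMatrix D *ᵥ realCoord α =
      Sum.elim (fun j => -2 * (α j).im) (fun j => 2 * (α j).re) := by
    rw [symplecticMatrix, realCoord, Matrix.fromBlocks_mulVec]
    congr 1 <;> ext j <;> simp [Matrix.smul_mulVec, Matrix.neg_mulVec]
  rw [h, symplectic_apply, dotProduct, Fintype.sum_sum_type, ← Finset.sum_add_distrib]
  refine Finset.sum_congr rfl fun j _ => ?_
  simp [realCoord]
  ring

theorem symplecticMatrix_mul_self : symplecticMatrix D * symplecticMatrix D = (-4 : ℝ) • 1 := by
  rw [symplecticMatrix, Matrix.fromBlocks_multiply, ← Matrix.fromBlocks_one,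
    Matrix.fromBlocks_smul]
  congr 1 <;> simp [smul_smul] <;> norm_num

/-- The inverse of `symplecticMatrix`. -/
noncomputable def symplecticMatrixInv (D : ℕ) : Matrix (Fin D ⊕ Fin D) (Fin D ⊕ Fin D) ℝ :=
  (-(1 / 4) : ℝ) • symplecticMatrix D

theorem symplecticMatrix_mul_inv : symplecticMatrix D * symplecticMatrixInv D = 1 := by
  rw [symplecticMatrixInv, Matrix.mul_smul, symplecticMatrix_mul_self, smul_smul]
  norm_num

/-- The linear map which is dual to the matrix `K` for the symplectic pairing. -/
noncomputable def symplecticDual (K : Matrix (Fin D ⊕ Fin D) (Fin D ⊕ Fin D) ℝ) :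
    (Fin D → ℂ) →ₗ[ℝ] (Fin D → ℂ) :=
  (realCoordEquiv D).symm.toLinearMap ∘ₗ
    Matrix.toLin' (symplecticMatrixInv D * Kᵀ * symplecticMatrix D) ∘ₗ
      (realCoordEquiv D).toLinearMap

theorem det_symplecticDual (K : Matrix (Fin D ⊕ Fin D) (Fin D ⊕ Fin D) ℝ) :
    LinearMap.det (symplecticDual K) = K.det := by
  have h := LinearMap.det_conj (Matrix.toLin' (symplecticMatrixInv D * Kᵀ * symplecticMatrix D))
    (realCoordEquiv D).symm
  rw [symplecticDual]
  refine h.trans ?_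
  have h2 := congrArg Matrix.det (symplecticMatrix_mul_inv (D := D))
  rw [Matrix.det_mul, Matrix.det_one] at h2
  rw [LinearMap.det_toLin', Matrix.det_mul, Matrix.det_mul, Matrix.det_transpose]
  linear_combination K.det * h2

/-- `symplecticDual K` is the adjoint of `K` for the symplectic form: substituting it in position
space applies `K` to the frequency. -/
theorem symplectic_symplecticDual (K : Matrix (Fin D ⊕ Fin D) (Fin D ⊕ Fin D) ℝ)
    (ξ α : Fin D → ℂ) :
    symplectic ξ (symplecticDual K α) =
      symplectic ((realCoordEquiv D).symm (K *ᵥ realCoord ξ)) α := by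
  have h : realCoord (symplecticDual K α) =
      (symplecticMatrixInv D * Kᵀ * symplecticMatrix D) *ᵥ realCoord α := realCoord_symm _
  rw [symplectic_eq_dotProduct, symplectic_eq_dotProduct, realCoord_symm, h, Matrix.mulVec_mulVec,
    ← Matrix.mul_assoc, ← Matrix.mul_assoc, symplecticMatrix_mul_inv, one_mul,
    ← Matrix.mulVec_mulVec, Matrix.dotProduct_mulVec, Matrix.vecMul_transpose]

theorem map_symplecticDual_volume {K : Matrix (Fin D ⊕ Fin D) (Fin D ⊕ Fin D) ℝ} (hK : K.det ≠ 0)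
    (m : Fin D → ℂ) :
    Measure.map (fun α => m + symplecticDual K α) (volume : Measure (Fin D → ℂ)) =
      ENNReal.ofReal |K.det|⁻¹ • volume := by
  have hvol : (volume : Measure (Fin D → ℂ)).IsAddHaarMeasure := Measure.pi.isAddHaarMeasure _
  have h := Measure.map_linearMap_addHaar_eq_smul_addHaar (volume : Measure (Fin D → ℂ))
    (f := symplecticDual K) (by rwa [det_symplecticDual])
  rw [det_symplecticDual, abs_inv] at h
  have hm : Measurable (symplecticDual K) :=
    (LinearMap.continuous_of_finiteDimensional _).measurable
  have h2 : (fun α => m + symplecticDual K α) = (fun α => m + α) ∘ symplecticDual K := rfl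
  rw [h2, ← Measure.map_map (measurable_const_add m) hm, h, Measure.map_smul, map_add_left_eq_self]

theorem measurableEmbedding_symplecticDual {K : Matrix (Fin D ⊕ Fin D) (Fin D ⊕ Fin D) ℝ}
    (hK : K.det ≠ 0) (m : Fin D → ℂ) : MeasurableEmbedding fun α => m + symplecticDual K α := by
  let e := LinearMap.equivOfDetNeZero (symplecticDual K) (by rwa [det_symplecticDual])
  exact (measurableEmbedding_addLeft m).comp
    e.toContinuousLinearEquiv.toHomeomorph.measurableEmbedding

theorem integral_comp_symplecticDual {E : Type} [NormedAddCommGroup E] [NormedSpace ℝ E]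
    {K : Matrix (Fin D ⊕ Fin D) (Fin D ⊕ Fin D) ℝ} (hK : K.det ≠ 0) (m : Fin D → ℂ)
    (g : (Fin D → ℂ) → E) :
    ∫ α, g (m + symplecticDual K α) = |K.det|⁻¹ • ∫ α, g α := by
  rw [← (measurableEmbedding_symplecticDual hK m).integral_map, map_symplecticDual_volume hK,
    integral_smul_measure, ENNReal.toReal_ofReal (by positivity)]

theorem integrable_comp_symplecticDual {E : Type} [NormedAddCommGroup E]
    {K : Matrix (Fin D ⊕ Fin D) (Fin D ⊕ Fin D) ℝ} (hK : K.det ≠ 0) (m : Fin D → ℂ)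
    (g : (Fin D → ℂ) → E) :
    Integrable (fun α => g (m + symplecticDual K α)) ↔ Integrable g := by
  have h := (measurableEmbedding_symplecticDual hK m).integrable_map_iff (μ := volume) (g := g)
  rw [map_symplecticDual_volume hK, integrable_smul_measure
    (by simpa using hK) ENNReal.ofReal_ne_top] at h
  exact h.symm

/-- The Husimi function of the vacuum. -/
noncomputable def vacuumHusimi (α : Fin D → ℂ) : ℝ := ∏ j, (Real.exp (-‖α j‖ ^ 2) / Real.pi)

theorem vacuumHusimi_pos (α : Fin D → ℂ) : 0 < vacuumHusimi α :=
  Finset.prod_pos fun _ _ => by positivity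

theorem integrable_exp_neg_mul_sq_norm {b : ℝ} (hb : 0 < b) :
    Integrable fun α : ℂ => Real.exp (-b * ‖α‖ ^ 2) := by
  have h := (GaussianFourier.integrable_cexp_neg_mul_sq_norm_add (V := ℂ) (b := (b : ℂ))
    (by simpa using hb) 0 0).norm
  refine h.congr (ae_of_all _ fun α => ?_)
  simp only [zero_mul, add_zero]
  rw [Complex.norm_exp]
  congr 1
  have : (-(b : ℂ) * (‖α‖ : ℂ) ^ 2) = ((-b * ‖α‖ ^ 2 : ℝ) : ℂ) := by push_cast; ring
  rw [this, Complex.ofReal_re]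

theorem vacuumHusimi_rpow (p : ℝ) (α : Fin D → ℂ) :
    vacuumHusimi α ^ p = ∏ j, (Real.exp (-p * ‖α j‖ ^ 2) * Real.pi ^ (-p)) := by
  rw [vacuumHusimi, ← Real.finsetProd_rpow _ _ fun _ _ => by positivity]
  refine Finset.prod_congr rfl fun j _ => ?_
  rw [Real.div_rpow (by positivity) (by positivity), ← Real.exp_mul, Real.rpow_neg (by positivity),
    div_eq_mul_inv]
  congr 2
  ring

theorem integrable_vacuumHusimi_rpow {p : ℝ} (hp : 0 < p) :
    Integrable fun α : Fin D → ℂ => vacuumHusimi α ^ p := by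
  simp_rw [vacuumHusimi_rpow]
  exact Integrable.fintype_prod (f := fun _ (z : ℂ) => Real.exp (-p * ‖z‖ ^ 2) * Real.pi ^ (-p))
    fun _ => (integrable_exp_neg_mul_sq_norm hp).mul_const _

theorem integrable_vacuumHusimi : Integrable (vacuumHusimi (D := D)) := by
  simpa using integrable_vacuumHusimi_rpow (D := D) one_pos

theorem integral_vacuumHusimi_rpow_pos {p : ℝ} (hp : 0 < p) :
    0 < ∫ α : Fin D → ℂ, vacuumHusimi α ^ p := by
  have h0 : ∀ α : Fin D → ℂ, 0 < vacuumHusimi α ^ p := fun α =>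
    Real.rpow_pos_of_pos (vacuumHusimi_pos α) p
  have h := integrable_vacuumHusimi_rpow (D := D) hp
  rw [integral_pos_iff_support_of_nonneg (fun α => (h0 α).le) h]
  have : (Function.support fun α : Fin D → ℂ => vacuumHusimi α ^ p) = Set.univ :=
    Set.eq_univ_of_forall fun α => (h0 α).ne'
  rw [this]
  have hvol : (volume : Measure (Fin D → ℂ)).IsAddHaarMeasure := Measure.pi.isAddHaarMeasure _
  exact NeZero.pos _

theorem integral_vacuumHusimi_phaseChar (ξ : Fin D → ℂ) :
    ∫ α, (vacuumHusimi α : ℂ) * phaseChar ξ α = ((Real.exp (-∑ j, ‖ξ j‖ ^ 2) : ℝ) : ℂ) := by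
  have h : ∀ α : Fin D → ℂ, (vacuumHusimi α : ℂ) * phaseChar ξ α =
      ∏ j, (1 / (Real.pi : ℂ) *
        Complex.exp (-(‖α j‖ ^ 2 : ℝ) + ξ j * conj (α j) + -conj (ξ j) * α j)) := by
    intro α
    rw [vacuumHusimi, phaseChar, Complex.exp_sum, Complex.ofReal_prod, ← Finset.prod_mul_distrib]
    refine Finset.prod_congr rfl fun j _ => ?_
    rw [Complex.ofReal_div, Complex.ofReal_exp, div_mul_eq_mul_div, ← Complex.exp_add,
      one_div_mul_eq_div]
    congr 2
    push_cast
    ring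
  simp_rw [h]
  rw [integral_fintype_prod_volume_eq_prod (fun j (z : ℂ) => 1 / (Real.pi : ℂ) *
        Complex.exp (-(‖z‖ ^ 2 : ℝ) + ξ j * conj z + -conj (ξ j) * z))]
  simp_rw [integral_const_mul, integral_cexp_neg_sq_norm_add_complex]
  rw [← Finset.sum_neg_distrib, Real.exp_sum, Complex.ofReal_prod]
  refine Finset.prod_congr rfl fun j _ => ?_
  have hpi : (Real.pi : ℂ) ≠ 0 := by exact_mod_cast Real.pi_ne_zero
  rw [← mul_assoc, one_div_mul_cancel hpi, one_mul, mul_neg, Complex.mul_conj', Complex.ofReal_exp]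
  push_cast
  rfl

end Bosonic

/-! ### Minkowski's determinant inequality -/

section Minkowski

variable {n : Type} [Fintype n]

/-- AM–GM is applied to the numbers `1/(1 + l i)` and to `l i/(1 + l i)`; the two arithmetic means
add up to one. -/
theorem one_add_prod_rpow_le [Nonempty n] {l : n → ℝ} (hl : ∀ i, 0 < l i) :
    1 + (∏ i, l i) ^ (1 / (Fintype.card n : ℝ)) ≤ (∏ i, (1 + l i)) ^ (1 / (Fintype.card n : ℝ)) := by
  have hN : (0 : ℝ) < Fintype.card n := by exact_mod_cast Fintype.card_pos
  set r := 1 / (Fintype.card n : ℝ) with hr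
  have hl1 : ∀ i, 0 < 1 + l i := fun i => by linarith [hl i]
  have hw : ∑ _i : n, r = 1 := by
    rw [Finset.sum_const, Finset.card_univ, nsmul_eq_mul, hr]
    field_simp
  have h1 := Real.geom_mean_le_arith_mean_weighted Finset.univ (fun _ => r) (fun i => 1 / (1 + l i))
    (fun _ _ => by positivity) hw (fun i _ => (one_div_pos.2 (hl1 i)).le)
  have h2 := Real.geom_mean_le_arith_mean_weighted Finset.univ (fun _ => r)
    (fun i => l i / (1 + l i)) (fun _ _ => by positivity) hw
    (fun i _ => (div_pos (hl i) (hl1 i)).le)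
  have hP : 0 < (∏ i, (1 + l i)) ^ r := Real.rpow_pos_of_pos (Finset.prod_pos fun i _ => hl1 i) _
  rw [Real.finsetProd_rpow _ _ (fun i _ => (one_div_pos.2 (hl1 i)).le), Finset.prod_div_distrib,
    Finset.prod_const_one, Real.div_rpow zero_le_one (Finset.prod_nonneg fun i _ => (hl1 i).le),
    Real.one_rpow] at h1
  rw [Real.finsetProd_rpow _ _ (fun i _ => (div_pos (hl i) (hl1 i)).le), Finset.prod_div_distrib,
    Real.div_rpow (Finset.prod_nonneg fun i _ => (hl i).le)
      (Finset.prod_nonneg fun i _ => (hl1 i).le)] at h2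
  have h3 : ∑ i, r * (1 / (1 + l i)) + ∑ i, r * (l i / (1 + l i)) = 1 := by
    rw [← Finset.sum_add_distrib]
    refine Eq.trans (Finset.sum_congr rfl fun i _ => ?_) hw
    have := (hl1 i).ne'
    field_simp
  have h4 := add_le_add h1 h2
  rw [h3, ← add_div, div_le_one hP] at h4
  exact h4

variable [DecidableEq n]

theorem Matrix.PosDef.exists_transpose_mul_self {A : Matrix n n ℝ} (hA : A.PosDef) :
    ∃ S : Matrix n n ℝ, A = Sᵀ * S ∧ S.det ≠ 0 := by
  open scoped MatrixOrder Matrix.Norms.L2Operator in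
  obtain ⟨S, hS⟩ := CStarAlgebra.nonneg_iff_eq_star_mul_self.mp hA.posSemidef.nonneg
  rw [Matrix.star_eq_conjTranspose, Matrix.conjTranspose_eq_transpose_of_trivial] at hS
  refine ⟨S, hS, fun h => ?_⟩
  have := hA.det_pos
  rw [hS, Matrix.det_mul, h, mul_zero] at this
  exact lt_irrefl _ this

theorem Matrix.PosDef.one_add_det_rpow_le [Nonempty n] {C : Matrix n n ℝ} (hC : C.PosDef) :
    1 + C.det ^ (1 / (Fintype.card n : ℝ)) ≤ (1 + C).det ^ (1 / (Fintype.card n : ℝ)) := by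
  have h1 : C.det = ∏ i, hC.1.eigenvalues i := by simpa using hC.1.det_eq_prod_eigenvalues
  have h2 : (1 + C).det = ∏ i, (1 + hC.1.eigenvalues i) := by
    -- The determinant of `1 + C` is, up to sign, the characteristic polynomial at `-1`.
    have h3 := congrArg (Polynomial.eval (-1)) hC.1.charpoly_eq
    rw [Matrix.eval_charpoly, Polynomial.eval_prod] at h3
    have h4 : Matrix.scalar n (-1 : ℝ) - C = -(1 + C) := by
      rw [map_neg, map_one]; abel
    rw [h4, Matrix.det_neg] at h3
    have h5 : ∏ i, Polynomial.eval (-1) (Polynomial.X - Polynomial.C ((hC.1.eigenvalues i : ℝ))) =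
        (-1) ^ Fintype.card n * ∏ i, (1 + hC.1.eigenvalues i) := by
      rw [← Finset.card_univ, ← Finset.prod_const, ← Finset.prod_mul_distrib]
      refine Finset.prod_congr rfl fun i _ => ?_
      simp
      ring
    have h6 := h3.trans h5
    exact mul_left_cancel₀ (pow_ne_zero _ (by norm_num)) h6
  rw [h1, h2]
  exact one_add_prod_rpow_le hC.eigenvalues_pos

/-- Minkowski's determinant inequality. -/
theorem Matrix.PosDef.det_rpow_add_le [Nonempty n] {A B : Matrix n n ℝ} (hA : A.PosDef)
    (hB : B.PosDef) :
    A.det ^ (1 / (Fintype.card n : ℝ)) + B.det ^ (1 / (Fintype.card n : ℝ)) ≤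
      (A + B).det ^ (1 / (Fintype.card n : ℝ)) := by
  -- Congruence by `S` reduces to `A = 1`, all determinants scaling by `det S ^ 2`.
  obtain ⟨S, rfl, hS⟩ := hA.exists_transpose_mul_self
  have hSu : IsUnit S.det := hS.isUnit
  have hC : ((S⁻¹)ᵀ * B * S⁻¹).PosDef := by
    have h := hB.conjTranspose_mul_mul_same (B := S⁻¹)
      (Matrix.mulVec_injective_of_isUnit ((Matrix.isUnit_iff_isUnit_det _).2
        (Matrix.isUnit_nonsing_inv_det _ hSu)))
    rwa [Matrix.conjTranspose_eq_transpose_of_trivial] at h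
  set C := (S⁻¹)ᵀ * B * S⁻¹ with hCdef
  have hBC : B = Sᵀ * C * S := by
    have h1 : Sᵀ * (S⁻¹)ᵀ = 1 := by
      rw [← Matrix.transpose_mul, Matrix.nonsing_inv_mul _ hSu, Matrix.transpose_one]
    calc B = (Sᵀ * (S⁻¹)ᵀ) * B * (S⁻¹ * S) := by
          rw [h1, Matrix.nonsing_inv_mul _ hSu, one_mul, mul_one]
      _ = Sᵀ * C * S := by rw [hCdef]; simp only [Matrix.mul_assoc]
  have hsum : Sᵀ * S + B = Sᵀ * (1 + C) * S := by
    rw [hBC, Matrix.mul_add, Matrix.add_mul, mul_one]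
  have hd : ∀ X : Matrix n n ℝ, (Sᵀ * X * S).det = S.det ^ 2 * X.det := by
    intro X
    rw [Matrix.det_mul, Matrix.det_mul, Matrix.det_transpose]
    ring
  have h1C : 0 < (1 + C).det := (Matrix.PosDef.one.add hC).det_pos
  rw [hsum, hd, hBC, hd, Matrix.det_mul, Matrix.det_transpose, ← sq,
    Real.mul_rpow (sq_nonneg _) hC.det_pos.le, Real.mul_rpow (sq_nonneg _) h1C.le]
  have := mul_le_mul_of_nonneg_left hC.one_add_det_rpow_le
    (Real.rpow_nonneg (sq_nonneg S.det) (1 / (Fintype.card n : ℝ)))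
  linarith

theorem Matrix.PosDef.det_rpow_concave [Nonempty n] {A B : Matrix n n ℝ} (hA : A.PosDef)
    (hB : B.PosDef) {s t : ℝ} (hs : 0 < s) (ht : 0 < t) :
    s * A.det ^ (1 / (Fintype.card n : ℝ)) + t * B.det ^ (1 / (Fintype.card n : ℝ)) ≤
      (s • A + t • B).det ^ (1 / (Fintype.card n : ℝ)) := by
  have hN : (Fintype.card n : ℝ) ≠ 0 := by exact_mod_cast Fintype.card_ne_zero
  have key : ∀ {s : ℝ} {A : Matrix n n ℝ}, 0 < s → A.PosDef →
      (s • A).det ^ (1 / (Fintype.card n : ℝ)) = s * A.det ^ (1 / (Fintype.card n : ℝ)) := by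
    intro s A hs hA
    rw [Matrix.det_smul, Real.mul_rpow (by positivity) hA.det_pos.le, ← Real.rpow_natCast,
      ← Real.rpow_mul hs.le, mul_one_div_cancel hN, Real.rpow_one]
  rw [← key hs hA, ← key ht hB]
  exact (hA.smul hs).det_rpow_add_le (hB.smul ht)

end Minkowski

/-! ### Entropy powers of Gaussian states -/

namespace Bosonic

variable {D : ℕ}

section GaussianDensity

variable {f : (Fin D → ℂ) → ℝ} {d : Fin D ⊕ Fin D → ℝ}
  {W : Matrix (Fin D ⊕ Fin D) (Fin D ⊕ Fin D) ℝ}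

/-- If `xᵀ W x ≤ 0` for some `x ≠ 0`, the transform has modulus at least one along the whole ray
through `x`, contradicting Riemann–Lebesgue. -/
theorem posDef_of_integral_phaseChar (hW : W.IsSymm)
    (hft : ∀ ξ, ∫ α, (f α : ℂ) * phaseChar ξ α =
      Complex.exp (Complex.I * ((d ⬝ᵥ realCoord ξ : ℝ) : ℂ)
        - (((realCoord ξ ⬝ᵥ W *ᵥ realCoord ξ) / 2 : ℝ) : ℂ))) : W.PosDef := by
  refine Matrix.PosDef.of_dotProduct_mulVec_pos ?_ fun x hx => ?_
  · rw [Matrix.IsHermitian, Matrix.conjTranspose_eq_transpose_of_trivial]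
    exact hW
  · rw [star_trivial]
    set ξ := (realCoordEquiv D).symm x with hξ
    have hx' : realCoord ξ = x := realCoord_symm x
    have hξ0 : ξ ≠ 0 := by
      rw [hξ]
      exact (realCoordEquiv D).symm.map_ne_zero_iff.2 hx
    by_contra! hneg
    have h1 := (tendsto_integral_phaseChar_smul f hξ0).norm
    rw [norm_zero] at h1
    have h2 : ∀ t : ℝ, 1 ≤ ‖∫ α, (f α : ℂ) * phaseChar (t • ξ) α‖ := by
      intro t
      have h3 : realCoord (t • ξ) = t • x := by
        rw [← realCoordEquiv_apply, map_smul, realCoordEquiv_apply, hx']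
      rw [hft, Complex.norm_exp, Real.one_le_exp_iff, h3]
      simp only [Complex.sub_re, Complex.mul_re, Complex.I_re, Complex.I_im, Complex.ofReal_re,
        Complex.ofReal_im, Matrix.mulVec_smul, smul_dotProduct, dotProduct_smul, smul_eq_mul]
      nlinarith [mul_nonneg (sq_nonneg t) (neg_nonneg.2 hneg)]
    have h4 := ge_of_tendsto h1 (Filter.Eventually.of_forall h2)
    linarith

/-- An affine substitution turns `f` into the vacuum Husimi function up to its Jacobian `δ`, by
Fourier uniqueness. One power of `δ` comes from the measure and `-p` powers from the integrand,
hence the exponent `1 - p`. -/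
theorem integral_rpow_of_integral_phaseChar (hf : Integrable f) (hf0 : ∀ α, 0 ≤ f α) (hW : W.IsSymm)
    (hft : ∀ ξ, ∫ α, (f α : ℂ) * phaseChar ξ α =
      Complex.exp (Complex.I * ((d ⬝ᵥ realCoord ξ : ℝ) : ℂ)
        - (((realCoord ξ ⬝ᵥ W *ᵥ realCoord ξ) / 2 : ℝ) : ℂ))) {p : ℝ} (hp : 0 < p) :
    Integrable (fun α => f α ^ p) ∧
      ∫ α, f α ^ p = √(W.det / 4 ^ D) ^ (1 - p) * ∫ α : Fin D → ℂ, vacuumHusimi α ^ p := by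
  -- The vacuum has `W = 2 · 1`, so `W/2` is factored; this is also the origin of `4 ^ D = det(2 ·
  -- 1)`.
  obtain ⟨K, hK, hKd⟩ := ((posDef_of_integral_phaseChar hW hft).smul
    (a := (1 / 2 : ℝ)) (by norm_num)).exists_transpose_mul_self
  have hWK : W = (2 : ℝ) • (Kᵀ * K) := by
    rw [← hK, smul_smul]; norm_num
  have hδ : √(W.det / 4 ^ D) = |K.det| := by
    rw [hWK, Matrix.det_smul, Matrix.det_mul, Matrix.det_transpose, Fintype.card_sum,
      Fintype.card_fin, ← Real.sqrt_sq_eq_abs]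
    congr 1
    have : (4 : ℝ) ^ D = 2 ^ (D + D) := by
      rw [← two_mul, pow_mul]; norm_num
    rw [this]
    field_simp
  set δ := |K.det| with hδdef
  have hδ0 : 0 < δ := abs_pos.2 hKd
  -- The translation that cancels the phase `exp(i d·x)`.
  set m : Fin D → ℂ := (realCoordEquiv D).symm (symplecticMatrixInv D *ᵥ d) with hm
  have hmd : ∀ ξ, symplectic ξ m = d ⬝ᵥ realCoord ξ := by
    intro ξ
    rw [symplectic_eq_dotProduct, hm, realCoord_symm, Matrix.mulVec_mulVec,
      symplecticMatrix_mul_inv, Matrix.one_mulVec, dotProduct_comm]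
  have hg : Integrable fun α => δ * f (m + symplecticDual K α) :=
    ((integrable_comp_symplecticDual hKd m f).2 hf).const_mul _
  have hae : (fun α => δ * f (m + symplecticDual K α)) =ᵐ[volume] vacuumHusimi := by
    refine ae_eq_of_integral_phaseChar_eq hg integrable_vacuumHusimi
      (fun α => mul_nonneg hδ0.le (hf0 _)) (fun α => (vacuumHusimi_pos α).le) fun ζ => ?_
    set ξ : Fin D → ℂ := (realCoordEquiv D).symm (K⁻¹ *ᵥ realCoord ζ) with hξ
    have hKξ : K *ᵥ realCoord ξ = realCoord ζ := by
      rw [hξ, realCoord_symm, Matrix.mulVec_mulVec, Matrix.mul_nonsing_inv _ hKd.isUnit,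
        Matrix.one_mulVec]
    have hζ : (realCoordEquiv D).symm (K *ᵥ realCoord ξ) = ζ := by
      rw [hKξ, ← realCoordEquiv_apply, LinearEquiv.symm_apply_apply]
    have h1 : ∀ α, ((δ * f (m + symplecticDual K α) : ℝ) : ℂ) * phaseChar ζ α =
        (δ * Complex.exp (-(((d ⬝ᵥ realCoord ξ : ℝ) : ℂ) * Complex.I))) *
          ((f (m + symplecticDual K α) : ℂ) * phaseChar ξ (m + symplecticDual K α)) := by
      intro α
      have h2 : phaseChar ζ α = Complex.exp (-(((d ⬝ᵥ realCoord ξ : ℝ) : ℂ) * Complex.I)) *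
          phaseChar ξ (m + symplecticDual K α) := by
        rw [phaseChar_eq_symplectic, phaseChar_eq_symplectic, ← Complex.exp_add, map_add, hmd,
          symplectic_symplecticDual, hζ]
        congr 1
        push_cast
        ring
      rw [h2, Complex.ofReal_mul]
      ring
    simp_rw [h1]
    rw [integral_const_mul, integral_comp_symplecticDual hKd m
      (fun β => (f β : ℂ) * phaseChar ξ β), hft, integral_vacuumHusimi_phaseChar,
      ← realCoord_dotProduct_self]
    have h3 : realCoord ξ ⬝ᵥ W *ᵥ realCoord ξ = 2 * (realCoord ζ ⬝ᵥ realCoord ζ) := by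
      rw [hWK, Matrix.smul_mulVec, dotProduct_smul, smul_eq_mul, ← Matrix.mulVec_mulVec, hKξ,
        Matrix.dotProduct_mulVec, Matrix.vecMul_transpose, hKξ]
    have hδc : (δ : ℂ) ≠ 0 := by exact_mod_cast hδ0.ne'
    rw [h3, Complex.real_smul, ← hδdef, Complex.ofReal_inv]
    have h4 : (δ : ℂ) * Complex.exp (-(((d ⬝ᵥ realCoord ξ : ℝ) : ℂ) * Complex.I)) *
        ((δ : ℂ)⁻¹ * Complex.exp (Complex.I * ((d ⬝ᵥ realCoord ξ : ℝ) : ℂ)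
          - ((2 * (realCoord ζ ⬝ᵥ realCoord ζ) / 2 : ℝ) : ℂ))) =
        (δ * (δ : ℂ)⁻¹) * (Complex.exp (-(((d ⬝ᵥ realCoord ξ : ℝ) : ℂ) * Complex.I)) *
        Complex.exp (Complex.I * ((d ⬝ᵥ realCoord ξ : ℝ) : ℂ)
          - ((2 * (realCoord ζ ⬝ᵥ realCoord ζ) / 2 : ℝ) : ℂ))) := by ring
    rw [h4, mul_inv_cancel₀ hδc, one_mul, ← Complex.exp_add, Complex.ofReal_exp]
    congr 1
    push_cast
    ring
  have hpow : (fun α => f (m + symplecticDual K α) ^ p) =ᵐ[volume]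
      fun α => δ ^ (-p) * vacuumHusimi α ^ p := by
    filter_upwards [hae] with α hα
    rw [← hα, Real.mul_rpow hδ0.le (hf0 _), ← mul_assoc, ← Real.rpow_add hδ0]
    simp
  have hint : Integrable fun α => f (m + symplecticDual K α) ^ p :=
    ((integrable_vacuumHusimi_rpow hp).const_mul _).congr hpow.symm
  refine ⟨(integrable_comp_symplecticDual hKd m fun α => f α ^ p).1 hint, ?_⟩
  have h5 := integral_comp_symplecticDual hKd m fun α => f α ^ p
  rw [integral_congr_ae hpow, integral_const_mul, smul_eq_mul, ← hδdef] at h5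
  rw [hδ, sub_eq_add_neg, Real.rpow_add hδ0, Real.rpow_one, mul_assoc, h5,
    mul_inv_cancel_left₀ hδ0.ne']

end GaussianDensity

variable {ρ ρX ρY : Matrix (Occ D) (Occ D) ℂ}

/-- `ρ` has the Gaussian characteristic function with parameters `d` and `V`. -/
def HasGaussianCharFn (ρ : Matrix (Occ D) (Occ D) ℂ) (d : Fin D ⊕ Fin D → ℝ)
    (V : Matrix (Fin D ⊕ Fin D) (Fin D ⊕ Fin D) ℝ) : Prop :=
  ∀ ξ : Fin D → ℂ, charFn ρ ξ = Complex.exp (Complex.I * ((d ⬝ᵥ realCoord ξ : ℝ) : ℂ)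
    - (((realCoord ξ ⬝ᵥ V *ᵥ realCoord ξ) / 2 : ℝ) : ℂ))

theorem HasGaussianCharFn.integral_husimi_phaseChar {d : Fin D ⊕ Fin D → ℝ}
    {V : Matrix (Fin D ⊕ Fin D) (Fin D ⊕ Fin D) ℝ} (h : HasGaussianCharFn ρ d V)
    (hρ : IsDensity ρ) (ξ : Fin D → ℂ) :
    ∫ α, (husimi ρ α : ℂ) * phaseChar ξ α =
      Complex.exp (Complex.I * ((d ⬝ᵥ realCoord ξ : ℝ) : ℂ)
        - (((realCoord ξ ⬝ᵥ (V + 1) *ᵥ realCoord ξ) / 2 : ℝ) : ℂ)) := by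
  rw [hρ.integral_husimi_phaseChar, h ξ, Complex.ofReal_exp, ← Complex.exp_add, Matrix.add_mulVec,
    Matrix.one_mulVec, dotProduct_add, realCoord_dotProduct_self]
  congr 1
  push_cast
  ring

theorem HasGaussianCharFn.posDef {d : Fin D ⊕ Fin D → ℝ}
    {V : Matrix (Fin D ⊕ Fin D) (Fin D ⊕ Fin D) ℝ} (h : HasGaussianCharFn ρ d V) (hV : V.IsSymm)
    (hρ : IsDensity ρ) : (V + 1).PosDef :=
  posDef_of_integral_phaseChar (hV.add Matrix.isSymm_one) (h.integral_husimi_phaseChar hρ)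

theorem HasGaussianCharFn.integral_husimi_rpow {d : Fin D ⊕ Fin D → ℝ}
    {V : Matrix (Fin D ⊕ Fin D) (Fin D ⊕ Fin D) ℝ} (h : HasGaussianCharFn ρ d V) (hV : V.IsSymm)
    (hρ : IsDensity ρ) {p : ℝ} (hp : 0 < p) :
    Integrable (fun α => husimi ρ α ^ p) ∧ ∫ α, husimi ρ α ^ p =
      √((V + 1).det / 4 ^ D) ^ (1 - p) * ∫ α : Fin D → ℂ, vacuumHusimi α ^ p :=
  integral_rpow_of_integral_phaseChar hρ.integrable_husimi hρ.husimi_nonneg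
    (hV.add Matrix.isSymm_one) (h.integral_husimi_phaseChar hρ) hp

theorem HasGaussianCharFn.integral_husimi_rpow_pos {d : Fin D ⊕ Fin D → ℝ}
    {V : Matrix (Fin D ⊕ Fin D) (Fin D ⊕ Fin D) ℝ} (h : HasGaussianCharFn ρ d V) (hV : V.IsSymm)
    (hρ : IsDensity ρ) {p : ℝ} (hp : 0 < p) : 0 < ∫ α, husimi ρ α ^ p := by
  rw [(h.integral_husimi_rpow hV hρ hp).2]
  have := (h.posDef hV hρ).det_pos
  exact mul_pos (Real.rpow_pos_of_pos (Real.sqrt_pos.2 (by positivity)) _)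
    (integral_vacuumHusimi_rpow_pos hp)

/-- The proportionality constant between the Wehrl–Rényi entropy power of a Gaussian state and the
normalized determinant of its Husimi covariance matrix. -/
noncomputable def wehrlConst (D : ℕ) (p : ℝ) : ℝ :=
  Real.exp (1 / (D : ℝ) * (-(1 / 2) * Real.log (4 ^ D) +
    1 / (1 - p) * Real.log (∫ α : Fin D → ℂ, vacuumHusimi α ^ p)))

/-- The prefactor `1/(1 - p)` cancels the exponent `1 - p`, and the square root turns `1/D` into
`1/(2D)`, the Minkowski exponent in dimension `2D`. -/
theorem HasGaussianCharFn.wehrlPower_eq {d : Fin D ⊕ Fin D → ℝ}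
    {V : Matrix (Fin D ⊕ Fin D) (Fin D ⊕ Fin D) ℝ} (h : HasGaussianCharFn ρ d V) (hV : V.IsSymm)
    (hρ : IsDensity ρ) {p : ℝ} (hp : 1 < p) :
    wehrlPower p ρ =
      wehrlConst D p * (V + 1).det ^ (1 / (Fintype.card (Fin D ⊕ Fin D) : ℝ)) := by
  have hdet := (h.posDef hV hρ).det_pos
  have hp1 : 1 - p ≠ 0 := by linarith
  have hδ : 0 < √((V + 1).det / 4 ^ D) := Real.sqrt_pos.2 (by positivity)
  have hc := integral_vacuumHusimi_rpow_pos (D := D) (p := p) (by linarith)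
  rw [wehrlPower, wehrlEntropy, (h.integral_husimi_rpow hV hρ (by linarith)).2,
    Real.log_mul (Real.rpow_pos_of_pos hδ _).ne' hc.ne', Real.log_rpow hδ,
    Real.log_sqrt (by positivity), Real.log_div hdet.ne' (by positivity), wehrlConst,
    Real.rpow_def_of_pos hdet, ← Real.exp_add, Fintype.card_sum, Fintype.card_fin]
  congr 1
  push_cast
  -- For `D = 0` both exponents are `1/0 = 0`.
  by_cases hD : (D : ℝ) = 0
  · simp [hD]
  · field_simp
    ring

theorem HasGaussianCharFn.quantumConv {dX dY : Fin D ⊕ Fin D → ℝ}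
    {VX VY : Matrix (Fin D ⊕ Fin D) (Fin D ⊕ Fin D) ℝ} (hX : HasGaussianCharFn ρX dX VX)
    (hY : HasGaussianCharFn ρY dY VY) (hρX : IsDensity ρX) (hρY : IsDensity ρY) {τ : ℝ}
    (hτ0 : 0 ≤ τ) (hτ1 : τ ≤ 1) :
    HasGaussianCharFn (quantumConv τ ρX ρY) (√τ • dX + √(1 - τ) • dY)
      (τ • VX + (1 - τ) • VY) := by
  intro ξ
  have hs : ∀ s : ℝ, realCoord (s • ξ) = s • realCoord ξ := fun s =>
    (realCoordEquiv D).map_smul s ξ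
  rw [charFn_quantumConv hρX hρY hτ0 hτ1, hX, hY, ← Complex.exp_add, hs, hs]
  congr 1
  have h1 := Real.mul_self_sqrt hτ0
  have h2 := Real.mul_self_sqrt (show 0 ≤ 1 - τ by linarith)
  simp only [Matrix.mulVec_smul, Matrix.add_mulVec, Matrix.smul_mulVec, smul_dotProduct,
    dotProduct_smul, add_dotProduct, dotProduct_add, smul_eq_mul, ← mul_assoc, h1, h2]
  push_cast
  ring

end Bosonic

theorem theorem1 (D : ℕ) (hD : 0 < D)
    (ρX ρY : Matrix (Bosonic.Occ D) (Bosonic.Occ D) ℂ)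
    (hX : Bosonic.IsGaussianState ρX) (hY : Bosonic.IsGaussianState ρY)
    (τ : ℝ) (hτ0 : 0 < τ) (hτ1 : τ < 1)
    (p κ : ℝ) (hp : 1 < p) (hκ : (p + 1) / 2 ≤ κ) :
    Bosonic.IsGaussianState (Bosonic.quantumConv τ ρX ρY) ∧
    (∀ ρ ∈ ({ρX, ρY, Bosonic.quantumConv τ ρX ρY} :
        Set (Matrix (Bosonic.Occ D) (Bosonic.Occ D) ℂ)),
      Integrable (fun α : Fin D → ℂ => Bosonic.husimi ρ α ^ p) ∧
        0 < ∫ α : Fin D → ℂ, Bosonic.husimi ρ α ^ p) ∧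
    τ ^ κ * Bosonic.wehrlPower p ρX ^ κ + (1 - τ) ^ κ * Bosonic.wehrlPower p ρY ^ κ
      ≤ Bosonic.wehrlPower p (Bosonic.quantumConv τ ρX ρY) ^ κ := by
  obtain ⟨hρX, dX, VX, hVX, hcX⟩ := hX
  obtain ⟨hρY, dY, VY, hVY, hcY⟩ := hY
  have hcX : Bosonic.HasGaussianCharFn ρX dX VX := hcX
  have hcY : Bosonic.HasGaussianCharFn ρY dY VY := hcY
  have hρZ := hρX.quantumConv hρY hτ0.le hτ1.le
  have hcZ := hcX.quantumConv hcY hρX hρY hτ0.le hτ1.le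
  have hVZ : (τ • VX + (1 - τ) • VY).IsSymm := (hVX.smul τ).add (hVY.smul (1 - τ))
  have hp0 : 0 < p := by linarith
  refine ⟨⟨hρZ, _, _, hVZ, hcZ⟩, ?_, ?_⟩
  · rintro ρ (rfl | rfl | rfl)
    · exact ⟨(hcX.integral_husimi_rpow hVX hρX hp0).1, hcX.integral_husimi_rpow_pos hVX hρX hp0⟩
    · exact ⟨(hcY.integral_husimi_rpow hVY hρY hp0).1, hcY.integral_husimi_rpow_pos hVY hρY hp0⟩
    · exact ⟨(hcZ.integral_husimi_rpow hVZ hρZ hp0).1, hcZ.integral_husimi_rpow_pos hVZ hρZ hp0⟩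
  · have hne : Nonempty (Fin D ⊕ Fin D) := ⟨Sum.inl ⟨0, hD⟩⟩
    have hτ1' : 0 < 1 - τ := by linarith
    have hκ1 : 1 ≤ κ := by linarith
    have hmink := (hcX.posDef hVX hρX).det_rpow_concave (hcY.posDef hVY hρY) hτ0 hτ1'
    -- The weights sum to one, so the vacuum term `1` passes through the mixture unchanged.
    have hW : τ • (VX + 1) + (1 - τ) • (VY + 1) = (τ • VX + (1 - τ) • VY) + 1 := by
      module
    rw [hW] at hmink
    have hC : 0 < Bosonic.wehrlConst D p := Real.exp_pos _
    have hlin : τ * Bosonic.wehrlPower p ρX + (1 - τ) * Bosonic.wehrlPower p ρY ≤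
        Bosonic.wehrlPower p (Bosonic.quantumConv τ ρX ρY) := by
      rw [hcX.wehrlPower_eq hVX hρX hp, hcY.wehrlPower_eq hVY hρY hp,
        hcZ.wehrlPower_eq hVZ hρZ hp]
      have := mul_le_mul_of_nonneg_left hmink hC.le
      linarith
    have hXpos : 0 < Bosonic.wehrlPower p ρX := Real.exp_pos _
    have hYpos : 0 < Bosonic.wehrlPower p ρY := Real.exp_pos _
    rw [← Real.mul_rpow hτ0.le hXpos.le, ← Real.mul_rpow hτ1'.le hYpos.le]
    -- For nonnegative `a`, `b` and `κ ≥ 1`, `a^κ + b^κ ≤ (a + b)^κ`; then `hlin` is raised to the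
    -- power `κ`.
    exact (Real.add_rpow_le_rpow_add (by positivity) (by positivity) hκ1).trans
      (Real.rpow_le_rpow (by positivity) hlin (by linarith))
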